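/- **Setting.** Let $H$ be a Hopf $*$-algebra over $\mathbb C$ with coproduct $\Delta$, counit $\epsilon$, antipode $S$, and let $h_1,h_2\in H$ be commuting selfadjoint elements with $\Delta h_i=1\otimes h_i+h_i\otimes 1$. An $H$-module is called a *weight module* if every vector is a finite sum of vectors $x$ of bidegree $(n_1,n_2)\in\mathbb Z^2$, i.e. $h_1x=n_1x$, $h_2x=n_2x$. Let $\mathcal A$ be a unital complex $*$-algebra which is an $H$-module algebra, $t\triangleright(ab)=m(\Delta t\triangleright(a\otimes b))$, $t\triangleright 1=\epsilon(t)1$, with $t\triangleright a^*=((St)^*\triangleright a)^*$, and which is a weight module. A *spectral triple* $(\mathcal A,\mathcal H,D)$ is a unital $*$-representation $\pi$ of $\mathcal A$ by bounded operators on a Hilbert space $\mathcal H$ with a selfadjoint operator $D$ with compact resolvent such that each $\pi(a)$ preserves the domain of $D$ and $[D,\pi(a)]$ is bounded. A *grading* is a bounded selfadjoint $\gamma$ with $\gamma^2=1$ which commutes with $\pi(\mathcal A)$, preserves the domain of $D$ and anticommutes with $D$. A *real structure* is an antiunitary $J$ preserving the domain of $D$ with $J^2=\varepsilon$, $DJ=\varepsilon'JD$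 ($\varepsilon,\varepsilon'=\pm1$), such that $\pi(a)$ and $[D,\pi(a)]$ commute with $J\pi(b)^*J^{-1}$ for all $a,b\in\mathcal A$. Let $(\mathcal A,\mathcal H,D)$ be a *symmetric* spectral triple with $H$ acting by isometries: there is a dense subspace $V\subset\mathcal H$ which is a core for $D$ and is invariant under $D$ and $\pi(\mathcal A)$, and a representation of $H$ on $V$ making $V$ a weight module, such that $\langle tv,w\rangle=\langle v,t^*w\rangle$, $t(av)=\mu(\Delta t\triangleright(a\otimes v))$ where $\mu(a\otimes v)=\pi(a)v$ (so the crossed product of $H$ and $\mathcal A$ is represented on $V$), and $D(tv)=t(Dv)$. **Twist.** Let $|\lambda|=1$ and $\Psi=\lambda^{-h_1\otimes h_2}$, the operator on tensor products of weight modules which multiplies $x\otimes y$ by $\lambda^{-n_1m_2}$ if $x,y$ have bidegrees $(n_1,n_2),(m_1,m_2)$. Let $U=\Psi_{(1)}S(\Psi_{(2)})=\lambda^{h_1h_2}$. The twisted Hopf algebra $H_\Psi$ has the algebra of $H$, acting on weight modules, with the group-like elements $\lambda^{\pm h_1},\lambda^{\pm h_2}$ (which occur in its coproducts) adjoined, the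 coproduct $\Delta_\Psi(T)=\Psi\,\Delta(T)\,\Psi^{-1}$ (acting on tensor products of weight modules), the counit $\epsilon$ and the antipode $S_\Psi(t)=US(t)U^{-1}$. Let $\mathcal A_\Psi=\{\underline a: a\in\mathcal A\}$ be the vector space $\mathcal A$ with product $\underline a*\underline b=\underline{m(\Psi^{-1}\triangleright(a\otimes b))}$, involution $\underline a^*=\underline{(U^{-1}\triangleright a)^*}$ and action $T\triangleright\underline a=\underline{T\triangleright a}$. The crossed product of $H_\Psi$ and $\mathcal A_\Psi$ is the algebra generated by both with the relations $T\underline a=(T_{(1)}\triangleright\underline a)\,T_{(2)}$, $\Delta_\Psi T=T_{(1)}\otimes T_{(2)}$. **Theorem.** 1. $\mathcal A_\Psi$ is an $H_\Psi$-module algebra: $T\triangleright(\underline a*\underline b)=\underline m(\Delta_\Psi(T)\triangleright(\underline a\otimes\underline b))$ for $T\in H_\Psi$, and, for $t\in H$, $t\triangleright \underline 1=\epsilon(t)\underline 1$ and $t\triangleright\underline a^*=((S_\Psi t)^*\triangleright\underline a)^*$. For $T\in H_\Psi$ and $\underline a\in \mathcal A_\Psi$ the expression $(T_{(1)}\triangleright\underline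 a)\otimes T_{(2)}$ is a finite sum in $\mathcal A_\Psi\otimes H_\Psi$. 2. There is a unital $*$-representation of $\mathcal A_\Psi$ by bounded operators on the same Hilbert space $\mathcal H$, which leaves $V$ invariant and is given there by $\underline a\,v=\mu(\Psi^{-1}(a\otimes v))$. It satisfies $T(\underline a v)=\underline\mu(\Delta_\Psi(T)(\underline a\otimes v))$ for $T\in H_\Psi$, where $\underline\mu(\underline a\otimes v)=\underline av$. Together with the action of $H_\Psi$ on $V$ it gives a representation of the crossed product of $H_\Psi$ and $\mathcal A_\Psi$ on $V$. 3. With this representation and the unchanged $D$, $(\mathcal A_\Psi,\mathcal H,D)$ is a spectral triple, and $H_\Psi$ acts by isometries: $D(Tv)=T(Dv)$ for $T\in H_\Psi$, $v\in V$. 4. If $\gamma$ is a grading of $(\mathcal A,\mathcal H,D)$ which preserves $V$ and commutes there with $H$, then $\gamma$ is a grading of $(\mathcal A_\Psi,\mathcal H,D)$ and commutes with $H_\Psi$ on $V$. If $J$ is a real structure of $(\mathcal A,\mathcal H,D)$ which preserves $V$ with $Jt=(St)^*J$ there for $t\in H$, then the antiunitary operator $\tilde J$ given on $V$ by $JU^{-1}$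 is a real structure of $(\mathcal A_\Psi,\mathcal H,D)$ with the same signs, it preserves $V$, and $\tilde Jt=(S_\Psi t)^*\tilde J$ on $V$ for $t\in H$. If moreover $\gamma$ is a grading as above and $J\gamma=\varepsilon''\gamma J$ with $\varepsilon''=\pm1$, then $\tilde J\gamma=\varepsilon''\gamma\tilde J$. -/

import Mathlib

open scoped TensorProduct InnerProductSpace ComplexConjugate

universe u v

noncomputable section

/-! ### Complex powers of generators of circle actions -/

section CirclePow

variable {M : Type*} [AddCommGroup M] [Module ℂ M]

theorem exists_circlePow (z : Circle) (T : Module.End ℂ M) :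
    ∃ f : Module.End ℂ M, ∀ (n : ℤ) (x : M), T x = (n : ℂ) • x → f x = ((z : ℂ) ^ n) • x := by
  classical
  have hind : iSupIndep (fun n : ℤ => T.eigenspace (n : ℂ)) :=
    T.eigenspaces_iSupIndep.comp (f := fun n : ℤ => (n : ℂ)) Int.cast_injective
  have hinj : Function.Injective (DirectSum.coeLinearMap (fun n : ℤ => T.eigenspace (n : ℂ))) :=
    hind.dfinsupp_lsum_injective
  obtain ⟨g, hg⟩ := LinearMap.exists_leftInverse_of_injective _ (LinearMap.ker_eq_bot.mpr hinj)
  refine ⟨(DirectSum.toModule ℂ ℤ M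
    (fun n => ((z : ℂ) ^ n) • (T.eigenspace (n : ℂ)).subtype)) ∘ₗ g, ?_⟩
  intro n x hx
  have hx' : x ∈ T.eigenspace (n : ℂ) := Module.End.mem_eigenspace_iff.mpr hx
  have h1 : DirectSum.coeLinearMap (fun n : ℤ => T.eigenspace (n : ℂ))
      (DirectSum.lof ℂ ℤ (fun n : ℤ => T.eigenspace (n : ℂ)) n ⟨x, hx'⟩) = x := by
    simp
  have h2 := LinearMap.congr_fun hg
    (DirectSum.lof ℂ ℤ (fun n : ℤ => T.eigenspace (n : ℂ)) n ⟨x, hx'⟩)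
  simp only [LinearMap.comp_apply, h1, LinearMap.id_apply] at h2
  simp [LinearMap.comp_apply, h2]

/-- `z ^ T` for a point `z` of the unit circle and an operator `T`: the operator which multiplies
an eigenvector of `T` with integer eigenvalue `n` by `z ^ n`. It is only used for operators whose
integer eigenvectors span the space, and then this property determines it uniquely. -/
def circlePow (z : Circle) (T : Module.End ℂ M) : Module.End ℂ M :=
  (exists_circlePow z T).choose

theorem circlePow_apply (z : Circle) {T : Module.End ℂ M} {n : ℤ} {x : M}
    (h : T x = (n : ℂ) • x) : circlePow z T x = ((z : ℂ) ^ n) • x :=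
  (exists_circlePow z T).choose_spec n x h

end CirclePow

/-! ### The symmetry algebra -/

/-- A Hopf `*`-algebra over `ℂ`: the coproduct and the counit respect the involution. -/
class IsHopfStar (H : Type v) [Ring H] [HopfAlgebra ℂ H] [StarRing H] [StarModule ℂ H] : Prop where
  comul_star : ∀ t : H, Coalgebra.comul (R := ℂ) (star t) = star (Coalgebra.comul (R := ℂ) t)
  counit_star : ∀ t : H, Coalgebra.counit (R := ℂ) (star t) = conj (Coalgebra.counit (R := ℂ) t)

/-- Two commuting selfadjoint primitive elements of `H`. -/
structure CartanPair (H : Type v) [Ring H] [HopfAlgebra ℂ H] [StarRing H] where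
  h₁ : H
  h₂ : H
  commute : Commute h₁ h₂
  comul_h₁ : Coalgebra.comul (R := ℂ) h₁ = 1 ⊗ₜ[ℂ] h₁ + h₁ ⊗ₜ[ℂ] 1
  comul_h₂ : Coalgebra.comul (R := ℂ) h₂ = 1 ⊗ₜ[ℂ] h₂ + h₂ ⊗ₜ[ℂ] 1
  star_h₁ : star h₁ = h₁
  star_h₂ : star h₂ = h₂

section Actions

variable {H : Type v} [Ring H] [HopfAlgebra ℂ H]
variable {M N : Type*} [AddCommGroup M] [Module ℂ M] [AddCommGroup N] [Module ℂ N]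

/-- The action of `H` on the tensor product of two `H`-modules, through the coproduct. -/
def tensorAct (ρ : H →ₐ[ℂ] Module.End ℂ M) (σ : H →ₐ[ℂ] Module.End ℂ N) :
    H →ₐ[ℂ] Module.End ℂ (M ⊗[ℂ] N) :=
  (Module.endTensorEndAlgHom (R := ℂ) (S := ℂ) (A := ℂ) (M := M) (N := N)).comp
    ((Algebra.TensorProduct.map ρ σ).comp (Bialgebra.comulAlgHom ℂ H))

variable [StarRing H]

/-- The elements of degree `(n₁, n₂)`. -/
def degreeSpace (P : CartanPair H) (ρ : H →ₐ[ℂ] Module.End ℂ M) (n : ℤ × ℤ) : Submodule ℂ M :=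
  (ρ P.h₁).eigenspace (n.1 : ℂ) ⊓ (ρ P.h₂).eigenspace (n.2 : ℂ)

/-- `h₁` and `h₂` act as generators of two commuting circle actions: every vector is a (finite) sum
of vectors of integer bidegree. -/
def IsBigraded (P : CartanPair H) (ρ : H →ₐ[ℂ] Module.End ℂ M) : Prop :=
  ⨆ n : ℤ × ℤ, degreeSpace P ρ n = ⊤

theorem mem_degreeSpace {P : CartanPair H} {ρ : H →ₐ[ℂ] Module.End ℂ M} {n : ℤ × ℤ} {x : M} :
    x ∈ degreeSpace P ρ n ↔ ρ P.h₁ x = (n.1 : ℂ) • x ∧ ρ P.h₂ x = (n.2 : ℂ) • x := by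
  simp [degreeSpace]

theorem IsBigraded.induction {P : CartanPair H} {ρ : H →ₐ[ℂ] Module.End ℂ M}
    (h : IsBigraded P ρ) {p : M → Prop} (h0 : p 0) (hadd : ∀ x y, p x → p y → p (x + y))
    (hom : ∀ n x, x ∈ degreeSpace P ρ n → p x) (x : M) : p x := by
  have hx : x ∈ ⨆ n : ℤ × ℤ, degreeSpace P ρ n := by rw [h]; trivial
  exact Submodule.iSup_induction _ (motive := p) hx hom h0 hadd

theorem tensorAct_tmul_of_primitive (ρ : H →ₐ[ℂ] Module.End ℂ M) (σ : H →ₐ[ℂ] Module.End ℂ N)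
    {h : H} (hh : Coalgebra.comul (R := ℂ) h = 1 ⊗ₜ[ℂ] h + h ⊗ₜ[ℂ] 1) (x : M) (y : N) :
    tensorAct ρ σ h (x ⊗ₜ y) = x ⊗ₜ σ h y + ρ h x ⊗ₜ y := by
  simp [tensorAct, hh, Module.endTensorEndAlgHom_apply]

theorem tmul_mem_degreeSpace {P : CartanPair H} {ρ : H →ₐ[ℂ] Module.End ℂ M}
    {σ : H →ₐ[ℂ] Module.End ℂ N} {m n : ℤ × ℤ} {x : M} {y : N}
    (hx : x ∈ degreeSpace P ρ m) (hy : y ∈ degreeSpace P σ n) :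
    x ⊗ₜ[ℂ] y ∈ degreeSpace P (tensorAct ρ σ) (m + n) := by
  rw [mem_degreeSpace] at hx hy ⊢
  rw [tensorAct_tmul_of_primitive _ _ P.comul_h₁, tensorAct_tmul_of_primitive _ _ P.comul_h₂,
    hx.1, hx.2, hy.1, hy.2]
  constructor <;>
  · simp only [TensorProduct.tmul_smul, ← TensorProduct.smul_tmul', Prod.fst_add, Prod.snd_add,
      Int.cast_add]
    rw [add_comm, ← add_smul]

theorem IsBigraded.tensor {P : CartanPair H} {ρ : H →ₐ[ℂ] Module.End ℂ M}
    {σ : H →ₐ[ℂ] Module.End ℂ N} (hρ : IsBigraded P ρ) (hσ : IsBigraded P σ) :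
    IsBigraded P (tensorAct ρ σ) := by
  rw [IsBigraded, eq_top_iff]
  intro x _
  induction x using TensorProduct.induction_on with
  | zero => exact zero_mem _
  | add x y hx hy => exact add_mem (hx trivial) (hy trivial)
  | tmul x y =>
    refine hρ.induction (p := fun x => x ⊗ₜ[ℂ] y ∈ ⨆ n, degreeSpace P (tensorAct ρ σ) n)
      (by simp) (fun a b ha hb => by rw [TensorProduct.add_tmul]; exact add_mem ha hb) ?_ x
    intro m a ha
    refine hσ.induction (p := fun y => a ⊗ₜ[ℂ] y ∈ ⨆ n, degreeSpace P (tensorAct ρ σ) n)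
      (by simp) (fun a b ha hb => by rw [TensorProduct.tmul_add]; exact add_mem ha hb) ?_ y
    intro n b hb
    exact Submodule.mem_iSup_of_mem (m + n) (tmul_mem_degreeSpace ha hb)

end Actions

/-- An `H`-module on which `h₁` and `h₂` generate circle actions. -/
structure WeightModule {H : Type v} [Ring H] [HopfAlgebra ℂ H] [StarRing H]
    (P : CartanPair H) where
  carrier : Type u
  [addCommGroup : AddCommGroup carrier]
  [module : Module ℂ carrier]
  act : H →ₐ[ℂ] Module.End ℂ carrier
  bigraded : IsBigraded P act

attribute [instance] WeightModule.addCommGroup WeightModule.module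

/-! ### The twisted symmetry

The twist `Ψ = λ ^ (-h₁ ⊗ h₂)` is not a finite sum of elements `x ⊗ y`: it lives in a completion of
`H ⊗ H`. The completions are realised by families of operators on weight modules, respectively on
tensor products of two weight modules. -/

section Twist

variable {H : Type v} [Ring H] [HopfAlgebra ℂ H] [StarRing H] {P : CartanPair H}

/-- The tensor product of weight modules. -/
def WeightModule.tensor (M N : WeightModule.{u} P) : WeightModule.{u} P where
  carrier := M.carrier ⊗[ℂ] N.carrier
  act := tensorAct M.act N.act
  bigraded := M.bigraded.tensor N.bigraded

section Operators

variable {M N : Type*} [AddCommGroup M] [Module ℂ M] [AddCommGroup N] [Module ℂ N]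

variable (P) in
/-- The twist `Ψ = λ ^ (-h₁ ⊗ h₂)`, acting on the tensor product of two `H`-modules. -/
def cartanTwist (z : Circle) (ρ : H →ₐ[ℂ] Module.End ℂ M) (σ : H →ₐ[ℂ] Module.End ℂ N) :
    Module.End ℂ (M ⊗[ℂ] N) :=
  circlePow z (-TensorProduct.map (ρ P.h₁) (σ P.h₂))

variable (P) in
/-- The inverse twist `Ψ⁻¹ = λ ^ (h₁ ⊗ h₂)`, acting on the tensor product of two `H`-modules. -/
def cartanTwistInv (z : Circle) (ρ : H →ₐ[ℂ] Module.End ℂ M) (σ : H →ₐ[ℂ] Module.End ℂ N) :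
    Module.End ℂ (M ⊗[ℂ] N) :=
  circlePow z (TensorProduct.map (ρ P.h₁) (σ P.h₂))

variable (P) in
/-- The element `U = Ψ₍₁₎ S(Ψ₍₂₎) = λ ^ (h₁ h₂)`, acting on an `H`-module. -/
def twistUOn (z : Circle) (ρ : H →ₐ[ℂ] Module.End ℂ M) : Module.End ℂ M :=
  circlePow z (ρ (P.h₁ * P.h₂))

variable (P) in
/-- The element `U⁻¹ = λ ^ (- h₁ h₂)`, acting on an `H`-module. -/
def twistUInvOn (z : Circle) (ρ : H →ₐ[ℂ] Module.End ℂ M) : Module.End ℂ M :=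
  circlePow z (-ρ (P.h₁ * P.h₂))

theorem cartanTwistInv_tmul (z : Circle) {ρ : H →ₐ[ℂ] Module.End ℂ M}
    {σ : H →ₐ[ℂ] Module.End ℂ N} {m n : ℤ × ℤ} {x : M} {y : N} (hx : x ∈ degreeSpace P ρ m)
    (hy : y ∈ degreeSpace P σ n) :
    cartanTwistInv P z ρ σ (x ⊗ₜ y) = ((z : ℂ) ^ (m.1 * n.2)) • (x ⊗ₜ y) := by
  rw [mem_degreeSpace] at hx hy
  apply circlePow_apply
  rw [TensorProduct.map_tmul, hx.1, hy.2]
  simp [TensorProduct.tmul_smul, ← TensorProduct.smul_tmul', smul_smul, mul_comm]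

theorem twistUInvOn_apply (z : Circle) {ρ : H →ₐ[ℂ] Module.End ℂ M} {n : ℤ × ℤ} {x : M}
    (hx : x ∈ degreeSpace P ρ n) : twistUInvOn P z ρ x = ((z : ℂ) ^ (-(n.1 * n.2))) • x := by
  rw [mem_degreeSpace] at hx
  apply circlePow_apply
  rw [map_mul, LinearMap.neg_apply, Module.End.mul_apply, hx.2, map_smul, hx.1, smul_smul]
  push_cast
  rw [neg_smul, mul_comm]

end Operators

variable (P) in
/-- The completion of `H`: families of operators, one on each weight module. -/
abbrev Completion : Type _ := ∀ M : WeightModule.{u} P, Module.End ℂ M.carrier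

/-- The image of `t : H` in the completion. -/
def toCompletion : H →ₐ[ℂ] Completion.{u} P :=
  AlgHom.pi fun M => M.act

variable (P) in
/-- The algebra of `H_Ψ`: the algebra of `H` (acting on weight modules) together with the group-like
elements `λ ^ (± h₁)` and `λ ^ (± h₂)`, which occur in the twisted coproducts of elements of `H`. -/
def twistedSymmetry (z : Circle) : Subalgebra ℂ (Completion.{u} P) :=
  Algebra.adjoin ℂ (Set.range (toCompletion (P := P)) ∪
    {fun M => circlePow z (M.act P.h₁), fun M => circlePow z⁻¹ (M.act P.h₁),
     fun M => circlePow z (M.act P.h₂), fun M => circlePow z⁻¹ (M.act P.h₂)})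

/-- The coproduct of `H_Ψ`, `T ↦ Ψ (Δ T) Ψ⁻¹`, acting on `M ⊗ N`. -/
def twistedComul (z : Circle) (T : Completion.{u} P) (M N : WeightModule.{u} P) :
    Module.End ℂ (M.carrier ⊗[ℂ] N.carrier) :=
  cartanTwist P z M.act N.act ∘ₗ T (M.tensor N) ∘ₗ cartanTwistInv P z M.act N.act

variable (P) in
/-- The adjoint of the antipode `S_Ψ(t) = U S(t) U⁻¹` of `H_Ψ`. As `h₁` and `h₂` are selfadjoint,
`U* = U⁻¹`, so that `(U S(t) U⁻¹)* = U S(t)* U⁻¹`. -/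
def starTwistedAntipode (z : Circle) (t : H) : Completion.{u} P :=
  fun M => twistUOn P z M.act * M.act (star (HopfAlgebra.antipode ℂ t)) * twistUInvOn P z M.act

end Twist

/-! ### Module algebras and their deformation -/

/-- An action of the Hopf `*`-algebra `H` on the `*`-algebra `A`, for which `h₁` and `h₂` generate
circle actions. -/
structure CartanAction {H : Type v} [Ring H] [HopfAlgebra ℂ H] [StarRing H] (P : CartanPair H)
    (A : Type u) [Ring A] [Algebra ℂ A] [StarRing A] where
  act : H →ₐ[ℂ] Module.End ℂ A
  act_mul : ∀ t a b, act t (a * b) = LinearMap.mul' ℂ A (tensorAct act act t (a ⊗ₜ b))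
  act_one : ∀ t, act t 1 = Coalgebra.counit (R := ℂ) t • (1 : A)
  act_star : ∀ t a, act t (star a) = star (act (star (HopfAlgebra.antipode ℂ t)) a)
  bigraded : IsBigraded P act

namespace CartanAction

variable {H : Type v} [Ring H] [HopfAlgebra ℂ H] [StarRing H] {P : CartanPair H}
variable {A : Type u} [Ring A] [Algebra ℂ A] [StarRing A] [StarModule ℂ A]

/-- The underlying space of the deformed algebra `A_Ψ`. -/
def Twisted (_𝒜 : CartanAction P A) (_z : Circle) : Type u := A

variable (𝒜 : CartanAction P A) (z : Circle)

instance : AddCommGroup (𝒜.Twisted z) := inferInstanceAs (AddCommGroup A)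
instance : Module ℂ (𝒜.Twisted z) := inferInstanceAs (Module ℂ A)

/-- The quantization map from `A` to `A_Ψ`. -/
def quant : A ≃ₗ[ℂ] 𝒜.Twisted z := LinearEquiv.refl ℂ A

/-- `A_Ψ` as a weight module, for the action of `H_Ψ` on `A_Ψ` which sends the image of `a` to the
image of `t ▷ a`. -/
def twistedWeightModule : WeightModule.{u} P where
  carrier := 𝒜.Twisted z
  act := 𝒜.act
  bigraded := 𝒜.bigraded

/-- The deformed product `m ∘ Ψ⁻¹`. -/
def twistedMul : A →ₗ[ℂ] A →ₗ[ℂ] A :=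
  TensorProduct.curry
    (LinearMap.mul' ℂ A ∘ₗ cartanTwistInv P z 𝒜.act 𝒜.act)

/-- The deformed involution `a ↦ (U⁻¹ ▷ a)*`. -/
def twistedStar (a : A) : A := star (twistUInvOn P z 𝒜.act a)

instance : Mul (𝒜.Twisted z) := ⟨fun a b => 𝒜.twistedMul z a b⟩
instance : One (𝒜.Twisted z) := ⟨(1 : A)⟩
instance : Star (𝒜.Twisted z) := ⟨𝒜.twistedStar z⟩

variable {𝒜 z}

theorem twistedMul_apply {m n : ℤ × ℤ} {a b : A} (ha : a ∈ degreeSpace P 𝒜.act m)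
    (hb : b ∈ degreeSpace P 𝒜.act n) :
    𝒜.twistedMul z a b = ((z : ℂ) ^ (m.1 * n.2)) • (a * b) := by
  rw [twistedMul, TensorProduct.curry_apply, LinearMap.comp_apply, cartanTwistInv_tmul z ha hb,
    map_smul, LinearMap.mul'_apply]

theorem mul_mem_degreeSpace {m n : ℤ × ℤ} {a b : A} (ha : a ∈ degreeSpace P 𝒜.act m)
    (hb : b ∈ degreeSpace P 𝒜.act n) : a * b ∈ degreeSpace P 𝒜.act (m + n) := by
  have h := mem_degreeSpace.mp (tmul_mem_degreeSpace ha hb)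
  rw [mem_degreeSpace, 𝒜.act_mul, 𝒜.act_mul, h.1, h.2]
  simp

theorem counit_primitive {h : H} (hh : Coalgebra.comul (R := ℂ) h = 1 ⊗ₜ[ℂ] h + h ⊗ₜ[ℂ] 1) :
    Coalgebra.counit (R := ℂ) h = 0 := by
  have h1 := congrArg (Coalgebra.counit (R := ℂ)) (Coalgebra.rTensor_counit_comul (R := ℂ) h |>
    congrArg (TensorProduct.lid ℂ H))
  simpa [hh] using h1

theorem antipode_primitive {h : H} (hh : Coalgebra.comul (R := ℂ) h = 1 ⊗ₜ[ℂ] h + h ⊗ₜ[ℂ] 1) :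
    HopfAlgebra.antipode ℂ h = -h := by
  have h1 := HopfAlgebra.mul_antipode_rTensor_comul_apply (R := ℂ) h
  rw [hh, counit_primitive hh] at h1
  simp at h1
  exact eq_neg_of_add_eq_zero_right h1

theorem one_mem_degreeSpace : (1 : A) ∈ degreeSpace P 𝒜.act 0 := by
  rw [mem_degreeSpace, 𝒜.act_one, 𝒜.act_one, counit_primitive P.comul_h₁,
    counit_primitive P.comul_h₂]
  simp

theorem star_mem_degreeSpace {n : ℤ × ℤ} {a : A} (ha : a ∈ degreeSpace P 𝒜.act n) :
    star a ∈ degreeSpace P 𝒜.act (-n) := by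
  rw [mem_degreeSpace] at ha ⊢
  rw [𝒜.act_star, 𝒜.act_star, antipode_primitive P.comul_h₁, antipode_primitive P.comul_h₂,
    star_neg, star_neg, P.star_h₁, P.star_h₂]
  simp [ha.1, ha.2, star_smul]

theorem twistedStar_apply {n : ℤ × ℤ} {a : A} (ha : a ∈ degreeSpace P 𝒜.act n) :
    𝒜.twistedStar z a = ((z : ℂ) ^ (n.1 * n.2)) • star a := by
  have hz : star ((z : ℂ) ^ (-(n.1 * n.2))) = (z : ℂ) ^ (n.1 * n.2) := by
    rw [star_zpow₀, ← starRingEnd_apply, ← Circle.coe_inv_eq_conj, Circle.coe_inv, inv_zpow',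
      neg_neg]
  rw [twistedStar, twistUInvOn_apply z ha, star_smul, hz]

theorem twistedStar_add (a b : A) :
    𝒜.twistedStar z (a + b) = 𝒜.twistedStar z a + 𝒜.twistedStar z b := by
  simp [twistedStar]

theorem twistedStar_smul (c : ℂ) (a : A) :
    𝒜.twistedStar z (c • a) = conj c • 𝒜.twistedStar z a := by
  simp [twistedStar, star_smul]

theorem twistedMul_assoc (a b c : A) :
    𝒜.twistedMul z (𝒜.twistedMul z a b) c = 𝒜.twistedMul z a (𝒜.twistedMul z b c) := by
  refine 𝒜.bigraded.induction (p := fun a => 𝒜.twistedMul z (𝒜.twistedMul z a b) c =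
    𝒜.twistedMul z a (𝒜.twistedMul z b c)) (by simp) (fun x y hx hy => by simp [hx, hy]) ?_ a
  intro l a ha
  refine 𝒜.bigraded.induction (p := fun b => 𝒜.twistedMul z (𝒜.twistedMul z a b) c =
    𝒜.twistedMul z a (𝒜.twistedMul z b c)) (by simp) (fun x y hx hy => by simp [hx, hy]) ?_ b
  intro m b hb
  refine 𝒜.bigraded.induction (p := fun c => 𝒜.twistedMul z (𝒜.twistedMul z a b) c =
    𝒜.twistedMul z a (𝒜.twistedMul z b c)) (by simp) (fun x y hx hy => by simp [hx, hy]) ?_ c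
  intro n c hc
  rw [twistedMul_apply ha hb, twistedMul_apply hb hc, map_smul, map_smul, LinearMap.smul_apply,
    twistedMul_apply (mul_mem_degreeSpace ha hb) hc,
    twistedMul_apply ha (mul_mem_degreeSpace hb hc), smul_smul, smul_smul, mul_assoc,
    ← zpow_add₀ (Circle.coe_ne_zero z), ← zpow_add₀ (Circle.coe_ne_zero z)]
  congr 2
  simp only [Prod.fst_add, Prod.snd_add]
  ring

theorem one_twistedMul (a : A) : 𝒜.twistedMul z 1 a = a := by
  refine 𝒜.bigraded.induction (p := fun a => 𝒜.twistedMul z 1 a = a) (by simp)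
    (fun x y hx hy => by simp [hx, hy]) ?_ a
  intro n a ha
  rw [twistedMul_apply one_mem_degreeSpace ha]
  simp

theorem twistedMul_one (a : A) : 𝒜.twistedMul z a 1 = a := by
  refine 𝒜.bigraded.induction (p := fun a => 𝒜.twistedMul z a 1 = a) (by simp)
    (fun x y hx hy => by simp [hx, hy]) ?_ a
  intro n a ha
  rw [twistedMul_apply ha one_mem_degreeSpace]
  simp

theorem twistedStar_twistedStar (a : A) : 𝒜.twistedStar z (𝒜.twistedStar z a) = a := by
  refine 𝒜.bigraded.induction (p := fun a => 𝒜.twistedStar z (𝒜.twistedStar z a) = a)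
    ?_ (fun x y hx hy => by simp only [twistedStar_add, hx, hy]) ?_ a
  · have h0 : 𝒜.twistedStar z 0 = 0 := by simpa using twistedStar_smul (𝒜 := 𝒜) (z := z) 0 0
    rw [h0, h0]
  intro n a ha
  rw [twistedStar_apply ha, twistedStar_smul, twistedStar_apply (star_mem_degreeSpace ha),
    smul_smul, star_star]
  have : conj ((z : ℂ) ^ (n.1 * n.2)) * (z : ℂ) ^ ((-n).1 * (-n).2) = 1 := by
    rw [map_zpow₀, ← Circle.coe_inv_eq_conj, Circle.coe_inv, inv_zpow', Prod.fst_neg, Prod.snd_neg,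
      neg_mul_neg, ← zpow_add₀ (Circle.coe_ne_zero z)]
    simp
  rw [this, one_smul]

theorem twistedStar_mul (a b : A) : 𝒜.twistedStar z (𝒜.twistedMul z a b) =
    𝒜.twistedMul z (𝒜.twistedStar z b) (𝒜.twistedStar z a) := by
  have h0 : 𝒜.twistedStar z 0 = 0 := by simpa using twistedStar_smul (𝒜 := 𝒜) (z := z) 0 0
  refine 𝒜.bigraded.induction (p := fun a => 𝒜.twistedStar z (𝒜.twistedMul z a b) =
    𝒜.twistedMul z (𝒜.twistedStar z b) (𝒜.twistedStar z a)) (by simp [h0])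
    (fun x y hx hy => by simp [twistedStar_add, hx, hy]) ?_ a
  intro m a ha
  refine 𝒜.bigraded.induction (p := fun b => 𝒜.twistedStar z (𝒜.twistedMul z a b) =
    𝒜.twistedMul z (𝒜.twistedStar z b) (𝒜.twistedStar z a)) (by simp [h0])
    (fun x y hx hy => by simp [twistedStar_add, hx, hy]) ?_ b
  intro n b hb
  rw [twistedMul_apply ha hb, twistedStar_smul, twistedStar_apply (mul_mem_degreeSpace ha hb),
    twistedStar_apply ha, twistedStar_apply hb, map_smul, map_smul, LinearMap.smul_apply,
    twistedMul_apply (star_mem_degreeSpace hb) (star_mem_degreeSpace ha), star_mul,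
    smul_smul, smul_smul, smul_smul]
  congr 1
  rw [map_zpow₀, ← Circle.coe_inv_eq_conj, Circle.coe_inv, inv_zpow',
    ← zpow_add₀ (Circle.coe_ne_zero z), ← zpow_add₀ (Circle.coe_ne_zero z),
    ← zpow_add₀ (Circle.coe_ne_zero z)]
  congr 1
  simp only [Prod.fst_add, Prod.snd_add, Prod.fst_neg, Prod.snd_neg]
  ring

variable (𝒜 z)

/-- The deformed algebra `A_Ψ`. -/
instance : Ring (𝒜.Twisted z) where
  __ := (inferInstance : AddCommGroup (𝒜.Twisted z))
  left_distrib a b c := map_add (𝒜.twistedMul z a) b c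
  right_distrib a b c := LinearMap.map_add₂ (𝒜.twistedMul z) a b c
  zero_mul a := LinearMap.map_zero₂ (𝒜.twistedMul z) a
  mul_zero a := map_zero (𝒜.twistedMul z a)
  mul_assoc a b c := twistedMul_assoc (𝒜 := 𝒜) (z := z) a b c
  one_mul a := one_twistedMul (𝒜 := 𝒜) (z := z) a
  mul_one a := twistedMul_one (𝒜 := 𝒜) (z := z) a

instance : Algebra ℂ (𝒜.Twisted z) :=
  Algebra.ofModule (fun c a b => LinearMap.map_smul₂ (𝒜.twistedMul z) c a b)
    (fun c a b => map_smul (𝒜.twistedMul z a) c b)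

/-- The deformed involution. -/
instance : StarRing (𝒜.Twisted z) where
  star_involutive a := twistedStar_twistedStar (𝒜 := 𝒜) (z := z) a
  star_mul a b := twistedStar_mul (𝒜 := 𝒜) (z := z) a b
  star_add a b := twistedStar_add (𝒜 := 𝒜) (z := z) a b

instance : StarModule ℂ (𝒜.Twisted z) where
  star_smul c a := twistedStar_smul (𝒜 := 𝒜) (z := z) c a

/-! ### The crossed product of `H_Ψ` and `A_Ψ` -/

/-- The element `∑ i, b i ⊗ T₂ i` of `A_Ψ ⊗ H_Ψ` is `(T₍₁₎ ▷ a) ⊗ T₍₂₎`, for the coproduct of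
`H_Ψ`. -/
def IsCoaction (T : twistedSymmetry.{u} P z) (a : 𝒜.Twisted z) {k : ℕ} (b : Fin k → 𝒜.Twisted z)
    (T₂ : Fin k → twistedSymmetry.{u} P z) : Prop :=
  ∀ (M : WeightModule.{u} P) (m : M.carrier),
    twistedComul z T.1 (𝒜.twistedWeightModule z) M ((a : 𝒜.Twisted z) ⊗ₜ[ℂ] m) =
      ∑ i, (b i) ⊗ₜ[ℂ] ((T₂ i).1 M m)

/-- The relations of the crossed product: those of `A_Ψ`, those of `H_Ψ`, and
`T a = (T₍₁₎ ▷ a) T₍₂₎`. -/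
inductive CrossedRel :
    FreeAlgebra ℂ (𝒜.Twisted z ⊕ twistedSymmetry.{u} P z) →
    FreeAlgebra ℂ (𝒜.Twisted z ⊕ twistedSymmetry.{u} P z) → Prop
  | alg_smul (c : ℂ) (a : 𝒜.Twisted z) :
      CrossedRel (FreeAlgebra.ι ℂ (Sum.inl (c • a))) (c • FreeAlgebra.ι ℂ (Sum.inl a))
  | alg_add (a b : 𝒜.Twisted z) : CrossedRel (FreeAlgebra.ι ℂ (Sum.inl (a + b)))
      (FreeAlgebra.ι ℂ (Sum.inl a) + FreeAlgebra.ι ℂ (Sum.inl b))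
  | alg_mul (a b : 𝒜.Twisted z) : CrossedRel (FreeAlgebra.ι ℂ (Sum.inl (a * b)))
      (FreeAlgebra.ι ℂ (Sum.inl a) * FreeAlgebra.ι ℂ (Sum.inl b))
  | alg_one : CrossedRel (FreeAlgebra.ι ℂ (Sum.inl 1)) 1
  | sym_smul (c : ℂ) (T : twistedSymmetry.{u} P z) :
      CrossedRel (FreeAlgebra.ι ℂ (Sum.inr (c • T))) (c • FreeAlgebra.ι ℂ (Sum.inr T))
  | sym_add (T T' : twistedSymmetry.{u} P z) : CrossedRel (FreeAlgebra.ι ℂ (Sum.inr (T + T')))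
      (FreeAlgebra.ι ℂ (Sum.inr T) + FreeAlgebra.ι ℂ (Sum.inr T'))
  | sym_mul (T T' : twistedSymmetry.{u} P z) : CrossedRel (FreeAlgebra.ι ℂ (Sum.inr (T * T')))
      (FreeAlgebra.ι ℂ (Sum.inr T) * FreeAlgebra.ι ℂ (Sum.inr T'))
  | sym_one : CrossedRel (FreeAlgebra.ι ℂ (Sum.inr 1)) 1
  | cross (T : twistedSymmetry.{u} P z) (a : 𝒜.Twisted z) (k : ℕ) (b : Fin k → 𝒜.Twisted z)
      (T₂ : Fin k → twistedSymmetry.{u} P z) (h : 𝒜.IsCoaction z T a b T₂) :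
      CrossedRel (FreeAlgebra.ι ℂ (Sum.inr T) * FreeAlgebra.ι ℂ (Sum.inl a))
        (∑ i, FreeAlgebra.ι ℂ (Sum.inl (b i)) * FreeAlgebra.ι ℂ (Sum.inr (T₂ i)))

/-- The crossed product of `H_Ψ` and `A_Ψ`. -/
abbrev CrossedProduct := RingQuot (CrossedRel.{u} 𝒜 z)

/-- The image of `a : A_Ψ` in the crossed product. -/
def CrossedProduct.ofAlg (a : 𝒜.Twisted z) : CrossedProduct.{u} 𝒜 z :=
  RingQuot.mkAlgHom ℂ _ (FreeAlgebra.ι ℂ (Sum.inl a))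

/-- The image of `T : H_Ψ` in the crossed product. -/
def CrossedProduct.ofSym (T : twistedSymmetry.{u} P z) : CrossedProduct.{u} 𝒜 z :=
  RingQuot.mkAlgHom ℂ _ (FreeAlgebra.ι ℂ (Sum.inr T))

end CartanAction

/-! ### Spectral triples -/

section SpectralTriple

variable {B 𝓗 : Type*} [Ring B] [Algebra ℂ B] [StarRing B]
variable [NormedAddCommGroup 𝓗] [InnerProductSpace ℂ 𝓗] [CompleteSpace 𝓗]

/-- `T` preserves the domain of `D`, and `C` is a bounded operator which extends `[D, T]`. -/
def IsCommutator (D : 𝓗 →ₗ.[ℂ] 𝓗) (T C : 𝓗 →L[ℂ] 𝓗) : Prop :=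
  ∀ x : D.domain, ∃ h : T x ∈ D.domain, D ⟨T x, h⟩ - T (D x) = C x

/-- For some `w : ℂ` the operator `D - w` has a compact bounded inverse. -/
def HasCompactResolvent (D : 𝓗 →ₗ.[ℂ] 𝓗) : Prop :=
  ∃ (w : ℂ) (R : 𝓗 →L[ℂ] 𝓗), IsCompactOperator R ∧
    (∀ y, ∃ h : R y ∈ D.domain, D ⟨R y, h⟩ - w • R y = y) ∧
    ∀ x : D.domain, R (D x - w • (x : 𝓗)) = x

/-- Spectral triples: a representation of a `*`-algebra by bounded operators and a selfadjoint
operator with compact resolvent which has bounded commutators with the algebra. -/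
structure IsSpectralTriple (π : B →⋆ₐ[ℂ] (𝓗 →L[ℂ] 𝓗)) (D : 𝓗 →ₗ.[ℂ] 𝓗) : Prop where
  dense_domain : Dense (D.domain : Set 𝓗)
  selfAdjoint : IsSelfAdjoint D
  compact_resolvent : HasCompactResolvent D
  bounded_commutator : ∀ b, ∃ C, IsCommutator D (π b) C

/-- `γ` is a grading of the spectral triple (even case). -/
structure IsGrading (π : B →⋆ₐ[ℂ] (𝓗 →L[ℂ] 𝓗)) (D : 𝓗 →ₗ.[ℂ] 𝓗) (γ : 𝓗 →L[ℂ] 𝓗) : Prop where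
  selfAdjoint : IsSelfAdjoint γ
  sq : γ * γ = 1
  comm : ∀ b, Commute (π b) γ
  anticomm : ∀ x : D.domain, ∃ h : γ x ∈ D.domain, D ⟨γ x, h⟩ = -γ (D x)

/-- The right action `b ↦ J π(b)* J⁻¹`. -/
def oppositeAct (π : B →⋆ₐ[ℂ] (𝓗 →L[ℂ] 𝓗)) (J : 𝓗 ≃ₗᵢ⋆[ℂ] 𝓗) (b : B) (x : 𝓗) : 𝓗 :=
  J (π (star b) (J.symm x))

/-- `J` is a real structure of the spectral triple with signs `J² = ε`, `D J = ε' J D`, which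
satisfies the order zero and the order one conditions. -/
structure IsRealStructure (π : B →⋆ₐ[ℂ] (𝓗 →L[ℂ] 𝓗)) (D : 𝓗 →ₗ.[ℂ] 𝓗) (J : 𝓗 ≃ₗᵢ⋆[ℂ] 𝓗)
    (ε ε' : ℤˣ) : Prop where
  sq : ∀ x, J (J x) = (ε : ℤ) • x
  comm : ∀ x : D.domain, ∃ h : J x ∈ D.domain, D ⟨J x, h⟩ = (ε' : ℤ) • J (D x)
  order_zero : ∀ a b x, π a (oppositeAct π J b x) = oppositeAct π J b (π a x)
  order_one : ∀ a b C, IsCommutator D (π a) C →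
    ∀ x, C (oppositeAct π J b x) = oppositeAct π J b (C x)

/-- The map `a ⊗ v ↦ a v` on an invariant subspace. -/
def moduleMap (π : B →⋆ₐ[ℂ] (𝓗 →L[ℂ] 𝓗)) (V : Submodule ℂ 𝓗)
    (h : ∀ b, ∀ v ∈ V, π b v ∈ V) : B ⊗[ℂ] V →ₗ[ℂ] V :=
  TensorProduct.lift
    { toFun := fun b => ((π b : 𝓗 →L[ℂ] 𝓗) : 𝓗 →ₗ[ℂ] 𝓗).restrict (h b)
      map_add' := fun a b => by ext v; simp [LinearMap.restrict_apply]
      map_smul' := fun c b => by ext v; simp [LinearMap.restrict_apply] }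

end SpectralTriple

/-- Symmetric spectral triples: spectral triples for `A` with a `*`-representation of `H` on a dense
subspace `V`, which is a core for `D` and invariant under `A` and `D`, such that the representations
of `H` and `A` give a representation of the crossed product, `h₁` and `h₂` generate circle actions,
and `H` acts by isometries, that is, commutes with `D`. -/
structure SymmetricSpectralTriple {H : Type v} [Ring H] [HopfAlgebra ℂ H] [StarRing H]
    {P : CartanPair H} {A : Type u} [Ring A] [Algebra ℂ A] [StarRing A] (𝒜 : CartanAction P A)
    (𝓗 : Type u) [NormedAddCommGroup 𝓗] [InnerProductSpace ℂ 𝓗] [CompleteSpace 𝓗] where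
  π : A →⋆ₐ[ℂ] (𝓗 →L[ℂ] 𝓗)
  D : 𝓗 →ₗ.[ℂ] 𝓗
  isSpectralTriple : IsSpectralTriple π D
  V : Submodule ℂ 𝓗
  dense : Dense (V : Set 𝓗)
  core : D.HasCore V
  π_mem : ∀ a, ∀ v ∈ V, π a v ∈ V
  D_mem : ∀ v : V, D ⟨v, core.le_domain v.2⟩ ∈ V
  rep : H →ₐ[ℂ] Module.End ℂ V
  rep_star : ∀ t (v w : V), ⟪((rep t v : V) : 𝓗), (w : 𝓗)⟫_ℂ = ⟪(v : 𝓗), ((rep (star t) w : V) : 𝓗)⟫_ℂ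
  rep_π : ∀ t a (v : V), rep t ⟨π a v, π_mem a v v.2⟩ =
    moduleMap π V π_mem (tensorAct 𝒜.act rep t (a ⊗ₜ v))
  bigraded : IsBigraded P rep
  rep_D : ∀ t (v : V), D ⟨rep t v, core.le_domain (rep t v).2⟩ =
    rep t ⟨D ⟨v, core.le_domain v.2⟩, D_mem v⟩

namespace SymmetricSpectralTriple

variable {H : Type v} [Ring H] [HopfAlgebra ℂ H] [StarRing H]
  {P : CartanPair H} {A : Type u} [Ring A] [Algebra ℂ A] [StarRing A] {𝒜 : CartanAction P A}
  {𝓗 : Type u} [NormedAddCommGroup 𝓗] [InnerProductSpace ℂ 𝓗] [CompleteSpace 𝓗]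

/-- The subspace `V` as a weight module. -/
def weightModule (X : SymmetricSpectralTriple 𝒜 𝓗) : WeightModule.{u} P where
  carrier := X.V
  act := X.rep
  bigraded := X.bigraded

/-- The restriction of `D` to the invariant core `V`. -/
def DV (X : SymmetricSpectralTriple 𝒜 𝓗) (v : X.V) : X.V :=
  ⟨X.D ⟨v, X.core.le_domain v.2⟩, X.D_mem v⟩

/-- The action on `V` of an element of the completion of `H`. -/
def actV (X : SymmetricSpectralTriple 𝒜 𝓗) (T : Completion.{u} P) : Module.End ℂ X.V :=
  T X.weightModule

end SymmetricSpectralTriple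

end

/-!
On weight modules the twist is diagonal: on vectors of bidegrees `m` and `n` the operator `Ψ⁻¹` is
multiplication by `λ ^ (m₁ n₂)`, and `U` multiplies a vector of bidegree `n` by `λ ^ (n₁ n₂)`.
Every identity between maps which are (anti)linear in each variable can therefore be checked on
homogeneous vectors, where it becomes an identity between exponents of `λ`.

The covariance statements need no computation. Elements of `H_Ψ` act naturally, that is, they commute
with all `H`-linear maps of weight modules (`twistedSymmetry_natural`). Multiplication in `A` and the
action of `A` on the core `V` are `H`-linear, the deformed maps are their compositions with `Ψ⁻¹`,
and `Δ_Ψ(T) = Ψ Δ(T) Ψ⁻¹`, so that the twists cancel (`natural_comp_cartanTwistInv`). Naturality also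
shows that `D` and gradings commute with `H_Ψ`. The coaction `(T₍₁₎ ▷ a) ⊗ T₍₂₎` is a finite sum
since, once `a` and the pieces of `t₍₁₎ ▷ a` are homogeneous, the twists only contribute powers of
`λ ^ h₂` in the second factor (`exists_twistedComul_eq`).

For the analysis, bidegrees are orthogonal because `h₁` and `h₂` are symmetric, so operators on `V`
which multiply homogeneous vectors by phases extend to unitary operators on the Hilbert space
(`exists_unitary_of_phase`). They commute with `D` on the core `V`, hence everywhere, as `D` is closed
(`isCommutator_zero_of_core`). A homogeneous `a` of bidegree `m` acts in the deformed representation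
as `π(a) λ ^ (m₁ h₂)`, which is bounded with bounded commutator `[D, π(a)] λ ^ (m₁ h₂)`
(`exists_twistedAct_extension`).

For the real structure `J' = J U⁻¹`, the operator `J` reverses bidegrees, and this gives
`J' π_Ψ(b)* J'⁻¹ = λ ^ (m₁ k₂) J π(b)* J⁻¹` on vectors of bidegree `m`, for `b` of bidegree `k`
(`oppositeAct_twistedRep`): the right action is deformed by the phase of `Ψ⁻¹` with the factors in
the other order. So left and right actions still commute, and so do the right action and the
commutators with `D`, which have the degree of `a` (`comm_oppositeAct_twistedRep`).
-/

/-! ### Linear maps on bigraded modules -/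

section Bigraded

variable {H : Type v} [Ring H] [HopfAlgebra ℂ H] [StarRing H] {P : CartanPair H}
variable {M N Q : Type*} [AddCommGroup M] [Module ℂ M] [AddCommGroup N] [Module ℂ N]
  [AddCommGroup Q] [Module ℂ Q]
variable {ρ : H →ₐ[ℂ] Module.End ℂ M} {σ : H →ₐ[ℂ] Module.End ℂ N}

theorem IsBigraded.hom_ext (hρ : IsBigraded P ρ) {f g : M →ₗ[ℂ] Q}
    (h : ∀ n, ∀ x ∈ degreeSpace P ρ n, f x = g x) : f = g :=
  LinearMap.ext fun x => hρ.induction (p := fun x => f x = g x) (by simp)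
    (fun x y hx hy => by simp [hx, hy]) h x

theorem IsBigraded.hom_ext₂ (hρ : IsBigraded P ρ) (hσ : IsBigraded P σ) {f g : M →ₗ[ℂ] N →ₗ[ℂ] Q}
    (h : ∀ m n, ∀ x ∈ degreeSpace P ρ m, ∀ y ∈ degreeSpace P σ n, f x y = g x y) : f = g :=
  hρ.hom_ext fun m x hx => hσ.hom_ext fun n y hy => h m n x hx y hy

theorem IsBigraded.tensor_hom_ext (hρ : IsBigraded P ρ) (hσ : IsBigraded P σ)
    {f g : M ⊗[ℂ] N →ₗ[ℂ] Q}
    (h : ∀ m n, ∀ x ∈ degreeSpace P ρ m, ∀ y ∈ degreeSpace P σ n, f (x ⊗ₜ y) = g (x ⊗ₜ y)) :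
    f = g := by
  refine TensorProduct.curry_injective (hρ.hom_ext₂ hσ fun m n x hx y hy => ?_)
  simpa using h m n x hx y hy

theorem cartanTwist_tmul (z : Circle) {m n : ℤ × ℤ} {x : M} {y : N} (hx : x ∈ degreeSpace P ρ m)
    (hy : y ∈ degreeSpace P σ n) :
    cartanTwist P z ρ σ (x ⊗ₜ y) = ((z : ℂ) ^ (-(m.1 * n.2))) • (x ⊗ₜ y) := by
  rw [mem_degreeSpace] at hx hy
  apply circlePow_apply
  rw [LinearMap.neg_apply, TensorProduct.map_tmul, hx.1, hy.2]
  simp [TensorProduct.tmul_smul, ← TensorProduct.smul_tmul', smul_smul, mul_comm]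

theorem twistUOn_apply (z : Circle) {n : ℤ × ℤ} {x : M} (hx : x ∈ degreeSpace P ρ n) :
    twistUOn P z ρ x = ((z : ℂ) ^ (n.1 * n.2)) • x := by
  rw [mem_degreeSpace] at hx
  apply circlePow_apply
  rw [map_mul, Module.End.mul_apply, hx.2, map_smul, hx.1, smul_smul]
  push_cast
  rw [mul_comm]

theorem circle_zpow_smul (z : Circle) (a b : ℤ) (x : M) :
    ((z : ℂ) ^ a) • ((z : ℂ) ^ b) • x = ((z : ℂ) ^ (a + b)) • x := by
  rw [smul_smul, zpow_add₀ (Circle.coe_ne_zero z)]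

theorem conj_circle_zpow (z : Circle) (a : ℤ) : conj ((z : ℂ) ^ a) = (z : ℂ) ^ (-a) := by
  rw [map_zpow₀, ← Circle.coe_inv_eq_conj, Circle.coe_inv, inv_zpow']

theorem cartanTwist_mul_cartanTwistInv (z : Circle) (hρ : IsBigraded P ρ) (hσ : IsBigraded P σ) :
    cartanTwist P z ρ σ * cartanTwistInv P z ρ σ = 1 :=
  hρ.tensor_hom_ext hσ fun m n x hx y hy => by
    simp [cartanTwistInv_tmul z hx hy, cartanTwist_tmul z hx hy, circle_zpow_smul, -zpow_neg]

theorem cartanTwistInv_mul_cartanTwist (z : Circle) (hρ : IsBigraded P ρ) (hσ : IsBigraded P σ) :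
    cartanTwistInv P z ρ σ * cartanTwist P z ρ σ = 1 :=
  hρ.tensor_hom_ext hσ fun m n x hx y hy => by
    simp [cartanTwistInv_tmul z hx hy, cartanTwist_tmul z hx hy, circle_zpow_smul, -zpow_neg]

theorem twistUInvOn_mul_twistUOn (z : Circle) (hρ : IsBigraded P ρ) :
    twistUInvOn P z ρ * twistUOn P z ρ = 1 :=
  hρ.hom_ext fun n x hx => by
    simp [twistUInvOn_apply z hx, twistUOn_apply z hx, circle_zpow_smul, -zpow_neg]

theorem map_mem_degreeSpace {f : M →ₗ[ℂ] N} (hf : ∀ t x, f (ρ t x) = σ t (f x)) {n : ℤ × ℤ} {x : M}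
    (hx : x ∈ degreeSpace P ρ n) : f x ∈ degreeSpace P σ n := by
  rw [mem_degreeSpace] at hx ⊢
  rw [← hf, ← hf, hx.1, hx.2, map_smul, map_smul]
  exact ⟨rfl, rfl⟩

end Bigraded

/-! ### The twisted symmetry and its coproduct -/

section TwistedSymmetry

variable {H : Type v} [Ring H] [HopfAlgebra ℂ H] [StarRing H] {P : CartanPair H} {z : Circle}

/-- Elements of `H_Ψ` act naturally: they commute with all `H`-linear maps of weight modules. -/
theorem twistedSymmetry_natural {T : Completion.{u} P} (hT : T ∈ twistedSymmetry P z)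
    {M N : WeightModule.{u} P} (f : M.carrier →ₗ[ℂ] N.carrier)
    (hf : ∀ t x, f (M.act t x) = N.act t (f x)) (x : M.carrier) : f (T M x) = T N (f x) := by
  induction hT using Algebra.adjoin_induction generalizing x with
  | mem T hT =>
    have key (w : Circle) (h : H) (c : ℤ × ℤ → ℤ)
        (hM : ∀ n, ∀ y ∈ degreeSpace P M.act n, M.act h y = (c n : ℂ) • y) :
        f (circlePow w (M.act h) x) = circlePow w (N.act h) (f x) := by
      refine LinearMap.congr_fun (f := f ∘ₗ circlePow w (M.act h))
        (g := circlePow w (N.act h) ∘ₗ f) (M.bigraded.hom_ext fun n y hy => ?_) x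
      have hy' : N.act h (f y) = (c n : ℂ) • f y := by rw [← hf, hM n y hy, map_smul]
      simp [circlePow_apply w (hM n y hy), circlePow_apply w hy']
    have h₁ n y (hy : y ∈ degreeSpace P M.act n) := (mem_degreeSpace.mp hy).1
    have h₂ n y (hy : y ∈ degreeSpace P M.act n) := (mem_degreeSpace.mp hy).2
    rcases hT with ⟨t, rfl⟩ | rfl | rfl | rfl | rfl
    · exact hf t x
    · exact key _ _ _ h₁
    · exact key _ _ _ h₁
    · exact key _ _ _ h₂
    · exact key _ _ _ h₂
  | algebraMap r => simp [Algebra.algebraMap_eq_smul_one]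
  | add S T _ _ hS hT => simp [hS, hT]
  | mul S T _ _ hS hT => simp [hS, hT]

/-- The powers of `λ ^ h₂` belong to `H_Ψ`. -/
theorem exists_twistedSymmetry_zpow (P : CartanPair H) (z : Circle) (k : ℤ) :
    ∃ T ∈ twistedSymmetry.{u} P z, ∀ (M : WeightModule.{u} P) (n : ℤ × ℤ),
      ∀ x ∈ degreeSpace P M.act n, T M x = ((z : ℂ) ^ (k * n.2)) • x := by
  have key (T : Completion.{u} P) (hT : T ∈ twistedSymmetry P z) (s : ℤ)
      (h : ∀ (M : WeightModule.{u} P) (n : ℤ × ℤ), ∀ x ∈ degreeSpace P M.act n,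
        T M x = ((z : ℂ) ^ (s * n.2)) • x) (j : ℕ) :
      ∃ T ∈ twistedSymmetry.{u} P z, ∀ (M : WeightModule.{u} P) (n : ℤ × ℤ),
        ∀ x ∈ degreeSpace P M.act n, T M x = ((z : ℂ) ^ (s * j * n.2)) • x := by
    refine ⟨T ^ j, pow_mem hT j, fun M n x hx => ?_⟩
    induction j with
    | zero => simp
    | succ j ih =>
      rw [pow_succ', Pi.mul_apply, Module.End.mul_apply, ih, map_smul, h M n x hx,
        circle_zpow_smul]
      congr 2
      push_cast
      ring
  obtain ⟨j, rfl | rfl⟩ := k.eq_nat_or_neg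
  · have := key (fun M => circlePow z (M.act P.h₂)) (Algebra.subset_adjoin (by simp)) 1
      (fun M n x hx => by rw [circlePow_apply z (mem_degreeSpace.mp hx).2, one_mul]) j
    simpa using this
  · have := key (fun M => circlePow z⁻¹ (M.act P.h₂)) (Algebra.subset_adjoin (by simp)) (-1)
      (fun M n x hx => by
        rw [circlePow_apply z⁻¹ (mem_degreeSpace.mp hx).2, Circle.coe_inv, inv_zpow', neg_one_mul])
      j
    simpa using this

/-- Evaluation of elements of `H_Ψ` at a vector of a weight module. -/
def evalAt (z : Circle) (M : WeightModule.{u} P) (x : M.carrier) :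
    twistedSymmetry.{u} P z →ₗ[ℂ] M.carrier :=
  LinearMap.applyₗ x ∘ₗ LinearMap.proj M ∘ₗ (twistedSymmetry.{u} P z).val.toLinearMap

theorem evalAt_apply (M : WeightModule.{u} P) (x : M.carrier) (T : twistedSymmetry.{u} P z) :
    evalAt z M x T = T.1 M x := rfl

theorem twistedComul_add (S T : Completion.{u} P) (M N : WeightModule.{u} P) :
    twistedComul z (S + T) M N = twistedComul z S M N + twistedComul z T M N :=
  LinearMap.ext fun _ => map_add (cartanTwist P z M.act N.act) _ _

theorem twistedComul_mul (S T : Completion.{u} P) (M N : WeightModule.{u} P)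
    (x : M.carrier ⊗[ℂ] N.carrier) :
    twistedComul z (S * T) M N x = twistedComul z S M N (twistedComul z T M N x) :=
  congrArg (fun y => cartanTwist P z M.act N.act (S (M.tensor N) y))
    (LinearMap.congr_fun (cartanTwistInv_mul_cartanTwist z M.bigraded N.bigraded)
      (T (M.tensor N) (cartanTwistInv P z M.act N.act x))).symm

theorem twistedComul_algebraMap (r : ℂ) (M N : WeightModule.{u} P) (x : M.carrier ⊗[ℂ] N.carrier) :
    twistedComul z (algebraMap ℂ _ r) M N x = r • x :=
  (map_smul (cartanTwist P z M.act N.act) r _).trans (congrArg (r • ·)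
    (LinearMap.congr_fun (cartanTwist_mul_cartanTwistInv z M.bigraded N.bigraded) x))

/-- The element `λ ^ h` is group-like in `H_Ψ`, for a primitive `h` which acts on vectors of
bidegree `n` by `c n`: it commutes with the twist. -/
theorem twistedComul_circlePow (w : Circle) {h : H}
    (hh : Coalgebra.comul (R := ℂ) h = 1 ⊗ₜ[ℂ] h + h ⊗ₜ[ℂ] 1) (c : ℤ × ℤ → ℤ)
    (hc : ∀ (M : WeightModule.{u} P) (n : ℤ × ℤ), ∀ x ∈ degreeSpace P M.act n,
      M.act h x = (c n : ℂ) • x) (M N : WeightModule.{u} P) (x : M.carrier) (y : N.carrier) :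
    twistedComul z (fun M => circlePow w (M.act h)) M N (x ⊗ₜ y) =
      circlePow w (M.act h) x ⊗ₜ circlePow w (N.act h) y := by
  refine LinearMap.congr_fun (f := twistedComul z (fun M => circlePow w (M.act h)) M N)
    (g := TensorProduct.map (circlePow w (M.act h)) (circlePow w (N.act h)))
    (M.bigraded.tensor_hom_ext N.bigraded fun m n x hx y hy => ?_) (x ⊗ₜ y)
  have hxy : (M.tensor N).act h (x ⊗ₜ y) = ((c m + c n : ℤ) : ℂ) • (x ⊗ₜ y) := by
    refine (tensorAct_tmul_of_primitive M.act N.act hh x y).trans ?_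
    rw [hc M m x hx, hc N n y hy, TensorProduct.tmul_smul, ← TensorProduct.smul_tmul', ← add_smul]
    push_cast
    rw [add_comm]
    rfl
  have hw : circlePow w ((M.tensor N).act h) (((z : ℂ) ^ (m.1 * n.2)) • (x ⊗ₜ[ℂ] y)) =
      ((w : ℂ) ^ (c m + c n)) • ((z : ℂ) ^ (m.1 * n.2)) • (x ⊗ₜ[ℂ] y) :=
    ((circlePow w ((M.tensor N).act h)).map_smul _ _).trans
      ((congrArg _ (circlePow_apply w hxy)).trans (smul_comm _ _ _))
  have h1 : twistedComul z (fun M => circlePow w (M.act h)) M N (x ⊗ₜ y) =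
      cartanTwist P z M.act N.act
        (((w : ℂ) ^ (c m + c n)) • ((z : ℂ) ^ (m.1 * n.2)) • (x ⊗ₜ[ℂ] y)) := by
    rw [← hw, ← cartanTwistInv_tmul z hx hy]
    rfl
  rw [h1, map_smul, map_smul, cartanTwist_tmul z hx hy, TensorProduct.map_tmul,
    circlePow_apply w (hc M m x hx), circlePow_apply w (hc N n y hy), circle_zpow_smul,
    add_neg_cancel, zpow_zero, one_smul, TensorProduct.tmul_smul, ← TensorProduct.smul_tmul',
    circle_zpow_smul, add_comm]

/-- The twist turns `x ⊗ S` into a finite sum of elements of the same kind: on a homogeneous `x`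
it acts through a power of `λ ^ h₂` in the second factor. -/
theorem exists_cartanTwist_eq (M : WeightModule.{u} P) (x : M.carrier)
    (S : twistedSymmetry.{u} P z) :
    ∃ θ : M.carrier ⊗[ℂ] twistedSymmetry.{u} P z, ∀ (N : WeightModule.{u} P) (y : N.carrier),
      cartanTwist P z M.act N.act (x ⊗ₜ[ℂ] S.1 N y) =
        TensorProduct.map LinearMap.id (evalAt z N y) θ := by
  refine M.bigraded.induction (p := fun x => ∃ θ : M.carrier ⊗[ℂ] twistedSymmetry.{u} P z,
    ∀ (N : WeightModule.{u} P) (y : N.carrier), cartanTwist P z M.act N.act (x ⊗ₜ[ℂ] S.1 N y) =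
      TensorProduct.map LinearMap.id (evalAt z N y) θ) ⟨0, by simp⟩ ?_ ?_ x
  · rintro x x' ⟨θ, hθ⟩ ⟨θ', hθ'⟩
    exact ⟨θ + θ', fun N y => by rw [TensorProduct.add_tmul, map_add, map_add, hθ, hθ']⟩
  · intro m x hx
    obtain ⟨E, hE, hE'⟩ := exists_twistedSymmetry_zpow.{u} P z (-m.1)
    refine ⟨x ⊗ₜ (⟨E, hE⟩ * S), fun N y => ?_⟩
    rw [TensorProduct.map_tmul, evalAt_apply]
    refine LinearMap.congr_fun (f := cartanTwist P z M.act N.act ∘ₗ TensorProduct.mk ℂ _ _ x)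
      (g := TensorProduct.mk ℂ _ _ x ∘ₗ E N) (N.bigraded.hom_ext fun n y hy => ?_) (S.1 N y)
    simp [cartanTwist_tmul z hx hy, hE' N n y hy]

/-- For `T` in `H_Ψ` the expression `(T₍₁₎ ▷ x) ⊗ T₍₂₎` is an element of the algebraic tensor
product. -/
theorem exists_twistedComul_eq {T : Completion.{u} P} (hT : T ∈ twistedSymmetry P z)
    (M : WeightModule.{u} P) (x : M.carrier) :
    ∃ θ : M.carrier ⊗[ℂ] twistedSymmetry.{u} P z, ∀ (N : WeightModule.{u} P) (y : N.carrier),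
      twistedComul z T M N (x ⊗ₜ[ℂ] y) = TensorProduct.map LinearMap.id (evalAt z N y) θ := by
  induction hT using Algebra.adjoin_induction generalizing x with
  | mem T hT =>
    have grp (w : Circle) (h : H) (hh : Coalgebra.comul (R := ℂ) h = 1 ⊗ₜ[ℂ] h + h ⊗ₜ[ℂ] 1)
        (c : ℤ × ℤ → ℤ) (hc : ∀ (M : WeightModule.{u} P) (n : ℤ × ℤ),
          ∀ x ∈ degreeSpace P M.act n, M.act h x = (c n : ℂ) • x)
        (hw : (fun M => circlePow w (M.act h)) ∈ twistedSymmetry.{u} P z) :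
        ∃ θ : M.carrier ⊗[ℂ] twistedSymmetry.{u} P z, ∀ (N : WeightModule.{u} P) (y : N.carrier),
          twistedComul z (fun M => circlePow w (M.act h)) M N (x ⊗ₜ[ℂ] y) =
            TensorProduct.map LinearMap.id (evalAt z N y) θ :=
      ⟨circlePow w (M.act h) x ⊗ₜ ⟨_, hw⟩, fun N y => by
        rw [twistedComul_circlePow w hh c hc]; rfl⟩
    have h₁ (M : WeightModule.{u} P) n y (hy : y ∈ degreeSpace P M.act n) :=
      (mem_degreeSpace.mp hy).1
    have h₂ (M : WeightModule.{u} P) n y (hy : y ∈ degreeSpace P M.act n) :=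
      (mem_degreeSpace.mp hy).2
    have hT' := Algebra.subset_adjoin (R := ℂ) hT
    rcases hT with ⟨t, rfl⟩ | rfl | rfl | rfl | rfl
    · -- By linearity it suffices to treat each term `t₁ ⊗ t₂` of the coproduct of `t`.
      suffices key : ∀ w : H ⊗[ℂ] H, ∃ θ : M.carrier ⊗[ℂ] twistedSymmetry.{u} P z,
          ∀ (N : WeightModule.{u} P) (y : N.carrier), cartanTwist P z M.act N.act
            (Module.endTensorEndAlgHom (R := ℂ) (S := ℂ) (A := ℂ)
              (Algebra.TensorProduct.map M.act N.act w)
              (cartanTwistInv P z M.act N.act (x ⊗ₜ[ℂ] y))) =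
            TensorProduct.map LinearMap.id (evalAt z N y) θ from key (Coalgebra.comul (R := ℂ) t)
      intro w
      induction w using TensorProduct.induction_on with
      | zero => exact ⟨0, by simp⟩
      | add w w' hw hw' =>
        obtain ⟨θ, hθ⟩ := hw
        obtain ⟨θ', hθ'⟩ := hw'
        exact ⟨θ + θ', fun N y => by
          rw [map_add, map_add, map_add, LinearMap.add_apply, map_add, hθ, hθ']⟩
      | tmul t₁ t₂ =>
        refine M.bigraded.induction (p := fun x => ∃ θ : M.carrier ⊗[ℂ] twistedSymmetry.{u} P z,
          ∀ (N : WeightModule.{u} P) (y : N.carrier), cartanTwist P z M.act N.act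
            (Module.endTensorEndAlgHom (R := ℂ) (S := ℂ) (A := ℂ)
              (Algebra.TensorProduct.map M.act N.act (t₁ ⊗ₜ t₂))
              (cartanTwistInv P z M.act N.act (x ⊗ₜ[ℂ] y))) =
            TensorProduct.map LinearMap.id (evalAt z N y) θ) ⟨0, by simp⟩ ?_ ?_ x
        · rintro x x' ⟨θ, hθ⟩ ⟨θ', hθ'⟩
          exact ⟨θ + θ', fun N y => by
            rw [TensorProduct.add_tmul, map_add, map_add, map_add, map_add, hθ, hθ']⟩
        · intro m x hx
          obtain ⟨E, hE, hE'⟩ := exists_twistedSymmetry_zpow.{u} P z m.1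
          obtain ⟨θ, hθ⟩ := exists_cartanTwist_eq M (M.act t₁ x)
            (⟨toCompletion t₂, Algebra.subset_adjoin (Or.inl ⟨t₂, rfl⟩)⟩ * ⟨E, hE⟩ :
              twistedSymmetry.{u} P z)
          refine ⟨θ, fun N y => ?_⟩
          have hy : cartanTwistInv P z M.act N.act (x ⊗ₜ[ℂ] y) = x ⊗ₜ E N y :=
            LinearMap.congr_fun
              (f := cartanTwistInv P z M.act N.act ∘ₗ TensorProduct.mk ℂ _ _ x)
              (g := TensorProduct.mk ℂ _ _ x ∘ₗ E N) (N.bigraded.hom_ext fun n y hy => by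
                simp [cartanTwistInv_tmul z hx hy, hE' N n y hy]) y
          rw [← hθ, hy, Algebra.TensorProduct.map_tmul, Module.endTensorEndAlgHom_apply]
          rfl
    · exact grp _ _ P.comul_h₁ _ h₁ hT'
    · exact grp _ _ P.comul_h₁ _ h₁ hT'
    · exact grp _ _ P.comul_h₂ _ h₂ hT'
    · exact grp _ _ P.comul_h₂ _ h₂ hT'
  | algebraMap r =>
    exact ⟨r • x ⊗ₜ 1, fun N y => by
      rw [twistedComul_algebraMap, map_smul, TensorProduct.map_tmul]; rfl⟩
  | add S T _ _ hS hT =>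
    obtain ⟨θ, hθ⟩ := hS x
    obtain ⟨θ', hθ'⟩ := hT x
    exact ⟨θ + θ', fun N y => by
      rw [twistedComul_add, LinearMap.add_apply, map_add, hθ, hθ']⟩
  | mul S T _ _ hS hT =>
    obtain ⟨θ, hθ⟩ := hT x
    suffices key : ∀ θ : M.carrier ⊗[ℂ] twistedSymmetry.{u} P z,
        ∃ θ' : M.carrier ⊗[ℂ] twistedSymmetry.{u} P z, ∀ (N : WeightModule.{u} P) (y : N.carrier),
          twistedComul z S M N (TensorProduct.map LinearMap.id (evalAt z N y) θ) =
            TensorProduct.map LinearMap.id (evalAt z N y) θ' by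
      obtain ⟨θ', hθ'⟩ := key θ
      exact ⟨θ', fun N y => by rw [twistedComul_mul, hθ, hθ']⟩
    intro θ
    induction θ using TensorProduct.induction_on with
    | zero => exact ⟨0, by simp⟩
    | add θ₁ θ₂ h₁ h₂ =>
      obtain ⟨θ₁', h₁⟩ := h₁
      obtain ⟨θ₂', h₂⟩ := h₂
      exact ⟨θ₁' + θ₂', fun N y => by rw [map_add, map_add, map_add, h₁, h₂]⟩
    | tmul x' R =>
      obtain ⟨θ', hθ'⟩ := hS x'
      refine ⟨TensorProduct.map LinearMap.id (LinearMap.mulRight ℂ R) θ', fun N y => ?_⟩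
      rw [TensorProduct.map_tmul, LinearMap.id_apply, evalAt_apply, hθ', ← LinearMap.comp_apply,
        ← TensorProduct.map_comp]
      rfl

/-- An `H`-linear map `f` out of a tensor product, composed with `Ψ⁻¹`, is covariant for the
twisted coproduct. -/
theorem natural_comp_cartanTwistInv {T : Completion.{u} P} (hT : T ∈ twistedSymmetry P z)
    {M N Q : WeightModule.{u} P} (f : M.carrier ⊗[ℂ] N.carrier →ₗ[ℂ] Q.carrier)
    (hf : ∀ t x, f (tensorAct M.act N.act t x) = Q.act t (f x)) (x : M.carrier ⊗[ℂ] N.carrier) :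
    T Q (f (cartanTwistInv P z M.act N.act x)) =
      f (cartanTwistInv P z M.act N.act (twistedComul z T M N x)) :=
  (twistedSymmetry_natural hT (M := M.tensor N) f hf _).symm.trans (congrArg f
    (LinearMap.congr_fun (cartanTwistInv_mul_cartanTwist z M.bigraded N.bigraded)
      (T (M.tensor N) (cartanTwistInv P z M.act N.act x))).symm)

end TwistedSymmetry

/-! ### Commutators with an unbounded operator -/

section Commutator

variable {𝓗 : Type*} [NormedAddCommGroup 𝓗] [InnerProductSpace ℂ 𝓗] {D : 𝓗 →ₗ.[ℂ] 𝓗}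
  {T T' C C' : 𝓗 →L[ℂ] 𝓗}

theorem IsCommutator.zero : IsCommutator D 0 0 := fun _ =>
  ⟨D.domain.zero_mem, (sub_zero _).trans D.map_zero⟩

theorem IsCommutator.add (h : IsCommutator D T C) (h' : IsCommutator D T' C') :
    IsCommutator D (T + T') (C + C') := fun x => by
  obtain ⟨hx, e⟩ := h x
  obtain ⟨hx', e'⟩ := h' x
  refine ⟨D.domain.add_mem hx hx', ?_⟩
  calc D (⟨T x, hx⟩ + ⟨T' x, hx'⟩) - (T (D x) + T' (D x)) = C x + C' x := by
        rw [D.map_add, add_sub_add_comm, e, e']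

/-- An operator which commutes with `D` can be absorbed in the commutator. -/
theorem IsCommutator.mul_of_comm {W : 𝓗 →L[ℂ] 𝓗} (h : IsCommutator D T C)
    (hW : IsCommutator D W 0) : IsCommutator D (T * W) (C * W) := fun x => by
  obtain ⟨hx, e⟩ := hW x
  obtain ⟨hy, e'⟩ := h ⟨W x, hx⟩
  refine ⟨hy, ?_⟩
  rw [zero_apply, sub_eq_zero] at e
  calc D ⟨T (W x), hy⟩ - T (W (D x)) = C (W x) := by rw [← e, e']

end Commutator

/-! ### Homogeneous vectors and phase operators on a symmetric spectral triple -/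

namespace SymmetricSpectralTriple

section Phases

variable {H : Type v} [Ring H] [HopfAlgebra ℂ H] [StarRing H]
  {P : CartanPair H} {A : Type u} [Ring A] [Algebra ℂ A] [StarRing A] {𝒜 : CartanAction P A}
  {𝓗 : Type u} [NormedAddCommGroup 𝓗] [InnerProductSpace ℂ 𝓗] [CompleteSpace 𝓗]
  (X : SymmetricSpectralTriple 𝒜 𝓗) {z : Circle}

theorem ext_on_core {S T : 𝓗 →L[ℂ] 𝓗} (h : ∀ v : X.V, S v = T v) : S = T :=
  ContinuousLinearMap.ext fun x =>
    congrFun (Continuous.ext_on X.dense S.continuous T.continuous fun v hv => h ⟨v, hv⟩) x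

/-- The restriction of `D` to the invariant core, as a linear map. -/
def coreD : X.V →ₗ[ℂ] X.V where
  toFun := X.DV
  map_add' v w := Subtype.ext (X.D.map_add ⟨v, X.core.le_domain v.2⟩ ⟨w, X.core.le_domain w.2⟩)
  map_smul' c v := Subtype.ext (X.D.map_smul c ⟨v, X.core.le_domain v.2⟩)

theorem coreD_rep (t : H) (v : X.V) : X.coreD (X.rep t v) = X.rep t (X.coreD v) :=
  Subtype.ext (X.rep_D t v)

theorem coreD_mem_degreeSpace {n : ℤ × ℤ} {v : X.V} (hv : v ∈ degreeSpace P X.rep n) :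
    X.coreD v ∈ degreeSpace P X.rep n :=
  map_mem_degreeSpace X.coreD_rep hv

/-- The action of the undeformed algebra on the core. -/
noncomputable def leftAct : A →ₗ[ℂ] X.V →ₗ[ℂ] X.V :=
  TensorProduct.curry (moduleMap X.π X.V X.π_mem)

theorem coe_leftAct (a : A) (v : X.V) : (X.leftAct a v : 𝓗) = X.π a v := rfl

theorem leftAct_mem_degreeSpace {m n : ℤ × ℤ} {a : A} {v : X.V} (ha : a ∈ degreeSpace P 𝒜.act m)
    (hv : v ∈ degreeSpace P X.rep n) : X.leftAct a v ∈ degreeSpace P X.rep (m + n) := by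
  have h := mem_degreeSpace.mp (tmul_mem_degreeSpace ha hv)
  have e (t : H) : X.rep t (X.leftAct a v) =
    moduleMap X.π X.V X.π_mem (tensorAct 𝒜.act X.rep t (a ⊗ₜ v)) := X.rep_π t a v
  rw [mem_degreeSpace, e, e, h.1, h.2, map_smul, map_smul]
  exact ⟨rfl, rfl⟩

/-- Vectors of different bidegrees are orthogonal, because `h₁` and `h₂` are symmetric. -/
theorem inner_eq_zero_of_degree_ne {m n : ℤ × ℤ} (hmn : m ≠ n) {v w : X.V}
    (hv : v ∈ degreeSpace P X.rep m) (hw : w ∈ degreeSpace P X.rep n) :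
    ⟪(v : 𝓗), (w : 𝓗)⟫_ℂ = 0 := by
  rw [mem_degreeSpace] at hv hw
  have key (h : H) (hh : star h = h) (i j : ℤ) (hi : X.rep h v = (i : ℂ) • v)
      (hj : X.rep h w = (j : ℂ) • w) (hij : i ≠ j) : ⟪(v : 𝓗), (w : 𝓗)⟫_ℂ = 0 := by
    have e := X.rep_star h v w
    rw [hh, hi, hj, Submodule.coe_smul, Submodule.coe_smul, inner_smul_left, inner_smul_right,
      map_intCast] at e
    exact (mul_eq_mul_right_iff.mp e).resolve_left fun e' => hij (by exact_mod_cast e')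
  by_cases h1 : m.1 = n.1
  · exact key _ P.star_h₂ _ _ hv.2 hw.2 fun h2 => hmn (Prod.ext h1 h2)
  · exact key _ P.star_h₁ _ _ hv.1 hw.1 h1

/-- Operators on the core which multiply homogeneous vectors by phases are isometric, and extend to
unitary operators on the Hilbert space. -/
theorem exists_unitary_of_phase {f g : Module.End ℂ X.V} (φ : ℤ × ℤ → ℤ)
    (hf : ∀ n, ∀ v ∈ degreeSpace P X.rep n, f v = ((z : ℂ) ^ φ n) • v)
    (hg : ∀ n, ∀ v ∈ degreeSpace P X.rep n, g v = ((z : ℂ) ^ (-φ n)) • v) :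
    ∃ W : 𝓗 ≃ₗᵢ[ℂ] 𝓗, ∀ v : X.V, W v = f v := by
  have hfg : f ∘ₗ g = LinearMap.id := X.bigraded.hom_ext fun n v hv => by
    rw [LinearMap.comp_apply, hg n v hv, map_smul, hf n v hv, circle_zpow_smul]
    simp
  have hgf : g ∘ₗ f = LinearMap.id := X.bigraded.hom_ext fun n v hv => by
    rw [LinearMap.comp_apply, hf n v hv, map_smul, hg n v hv, circle_zpow_smul]
    simp
  have hin (v w : X.V) : ⟪(f v : 𝓗), (w : 𝓗)⟫_ℂ = ⟪(v : 𝓗), (g w : 𝓗)⟫_ℂ := by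
    refine X.bigraded.induction (p := fun v => ⟪(f v : 𝓗), (w : 𝓗)⟫_ℂ = ⟪(v : 𝓗), (g w : 𝓗)⟫_ℂ)
      (by simp) (fun x y hx hy => by simp [hx, hy]) (fun m v hv => ?_) v
    refine X.bigraded.induction (p := fun w => ⟪(f v : 𝓗), (w : 𝓗)⟫_ℂ = ⟪(v : 𝓗), (g w : 𝓗)⟫_ℂ)
      (by simp) (fun x y hx hy => by simp [hx, hy]) (fun n w hw => ?_) w
    rw [hf m v hv, hg n w hw, Submodule.coe_smul, Submodule.coe_smul, inner_smul_left,
      inner_smul_right, conj_circle_zpow]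
    by_cases hmn : m = n
    · rw [hmn]
    · rw [X.inner_eq_zero_of_degree_ne hmn hv hw, mul_zero, mul_zero]
  have hd : DenseRange X.V.subtype := by
    have := X.dense
    rwa [DenseRange, Submodule.coe_subtype, Subtype.range_coe]
  refine ⟨(LinearEquiv.ofLinearMap f g hfg hgf).extendOfIsometry X.V.subtype X.V.subtype hd hd
    fun v => ?_, fun v => LinearEquiv.extendOfIsometry_eq _ _ _ hd hd _ v⟩
  have h := hin v (f v)
  rw [show g (f v) = v from LinearMap.congr_fun hgf v, inner_self_eq_norm_sq_to_K,
    inner_self_eq_norm_sq_to_K] at h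
  exact (sq_eq_sq₀ (norm_nonneg _) (norm_nonneg _)).mp (by exact_mod_cast h)

/-- A bounded operator which commutes with `D` on the core commutes with `D`. -/
theorem isCommutator_zero_of_core {W : 𝓗 →L[ℂ] 𝓗} {f : Module.End ℂ X.V}
    (hW : ∀ v : X.V, W v = f v) (hf : ∀ v, X.coreD (f v) = f (X.coreD v)) :
    IsCommutator X.D W 0 := by
  intro x
  have hcl : X.D.IsClosed := X.isSpectralTriple.selfAdjoint.isClosed
  have hle : X.D.domRestrict X.V ≤ X.D := LinearPMap.domRestrict_le
  have hgr := (hcl.isClosable.leIsClosable hle).graph_closure_eq_closure_graph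
  rw [X.core.closure_eq] at hgr
  have hx : ((x : 𝓗), X.D x) ∈ closure ((X.D.domRestrict X.V).graph : Set (𝓗 × 𝓗)) := by
    rw [← Submodule.topologicalClosure_coe, hgr]
    exact X.D.mem_graph x
  have hmem : (W x, W (X.D x)) ∈ closure (X.D.graph : Set (𝓗 × 𝓗)) := by
    refine map_mem_closure (f := fun p : 𝓗 × 𝓗 => (W p.1, W p.2)) (by fun_prop) hx ?_
    rintro ⟨p, q⟩ hpq
    obtain ⟨y, rfl, rfl⟩ := (LinearPMap.mem_graph_iff _).mp hpq
    have hy : (y : 𝓗) ∈ X.V := y.2.1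
    have e1 : X.D.domRestrict X.V y = X.coreD ⟨y, hy⟩ := hle.2 rfl
    refine (LinearPMap.mem_graph_iff _).mpr
      ⟨⟨f ⟨y, hy⟩, X.core.le_domain (f ⟨y, hy⟩).2⟩, (hW ⟨y, hy⟩).symm, ?_⟩
    rw [e1]
    exact (congrArg Subtype.val (hf _)).trans (hW _).symm
  rw [IsClosed.closure_eq hcl] at hmem
  obtain ⟨y, hy, hy'⟩ := (LinearPMap.mem_graph_iff _).mp hmem
  have hm : W x ∈ X.D.domain := (show (y : 𝓗) = W x from hy) ▸ y.2
  refine ⟨hm, ?_⟩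
  rw [show (⟨W x, hm⟩ : X.D.domain) = y from Subtype.ext hy.symm, hy', sub_self, zero_apply]

theorem coreD_comm_of_phase {f : Module.End ℂ X.V} (φ : ℤ × ℤ → ℤ)
    (hf : ∀ n, ∀ v ∈ degreeSpace P X.rep n, f v = ((z : ℂ) ^ φ n) • v) (v : X.V) :
    X.coreD (f v) = f (X.coreD v) :=
  LinearMap.congr_fun (f := X.coreD ∘ₗ f) (g := f ∘ₗ X.coreD) (X.bigraded.hom_ext fun n v hv => by
    rw [LinearMap.comp_apply, LinearMap.comp_apply, hf n v hv,
      hf n _ (X.coreD_mem_degreeSpace hv), map_smul]) v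

/-- For every integer `k` the operator `λ ^ (k h₂)` on the core extends to a unitary operator which
commutes with `D`. -/
theorem exists_unitary_zpow (z : Circle) (k : ℤ) : ∃ W : 𝓗 →L[ℂ] 𝓗, IsCommutator X.D W 0 ∧
    ∀ n, ∀ v ∈ degreeSpace P X.rep n, W v = ((z : ℂ) ^ (k * n.2)) • (v : 𝓗) := by
  have key (k : ℤ) (n : ℤ × ℤ) (v : X.V) (hv : v ∈ degreeSpace P X.rep n) :
      circlePow (z ^ k) (X.rep P.h₂) v = ((z : ℂ) ^ (k * n.2)) • v := by
    rw [circlePow_apply _ (mem_degreeSpace.mp hv).2, Circle.coe_zpow, zpow_mul]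
  obtain ⟨W, hW⟩ := X.exists_unitary_of_phase (z := z) (fun n => k * n.2) (key k)
    (g := circlePow (z ^ (-k)) (X.rep P.h₂)) fun n v hv => by rw [key (-k) n v hv, neg_mul]
  refine ⟨W.toContinuousLinearEquiv.toContinuousLinearMap,
    X.isCommutator_zero_of_core hW (X.coreD_comm_of_phase _ (key k)), fun n v hv => ?_⟩
  refine (hW v).trans ?_
  rw [key k n v hv]
  rfl

/-! ### The deformed representation -/

/-- The action `a ⊗ v ↦ μ (Ψ⁻¹ (a ⊗ v))` of the deformed algebra on the core. -/
noncomputable def twistedAct (z : Circle) : A →ₗ[ℂ] X.V →ₗ[ℂ] X.V :=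
  TensorProduct.curry (moduleMap X.π X.V X.π_mem ∘ₗ cartanTwistInv P z 𝒜.act X.rep)

theorem twistedAct_apply {m n : ℤ × ℤ} {a : A} {v : X.V} (ha : a ∈ degreeSpace P 𝒜.act m)
    (hv : v ∈ degreeSpace P X.rep n) :
    X.twistedAct z a v = ((z : ℂ) ^ (m.1 * n.2)) • X.leftAct a v := by
  rw [twistedAct, TensorProduct.curry_apply, LinearMap.comp_apply, cartanTwistInv_tmul z ha hv,
    map_smul]
  rfl

/-- The deformed action is by bounded operators with bounded commutators with `D`: for a homogeneous
`a` it is `π(a)` times a unitary operator which commutes with `D`. -/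
theorem exists_twistedAct_extension (z : Circle) (a : A) : ∃ T C : 𝓗 →L[ℂ] 𝓗,
    (∀ v : X.V, T v = X.twistedAct z a v) ∧ IsCommutator X.D T C := by
  refine 𝒜.bigraded.induction (p := fun a => ∃ T C : 𝓗 →L[ℂ] 𝓗,
    (∀ v : X.V, T v = X.twistedAct z a v) ∧ IsCommutator X.D T C)
    ⟨0, 0, by simp, .zero⟩ ?_ ?_ a
  · rintro a b ⟨T, C, hT, hC⟩ ⟨T', C', hT', hC'⟩
    exact ⟨T + T', C + C', fun v => by simp [hT, hT'], hC.add hC'⟩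
  · intro m a ha
    obtain ⟨W, hWD, hW⟩ := X.exists_unitary_zpow z m.1
    obtain ⟨C, hC⟩ := X.isSpectralTriple.bounded_commutator a
    refine ⟨X.π a * W, C * W, fun v => ?_, hC.mul_of_comm hWD⟩
    refine LinearMap.congr_fun (f := ((X.π a * W : 𝓗 →L[ℂ] 𝓗) : 𝓗 →ₗ[ℂ] 𝓗) ∘ₗ X.V.subtype)
      (g := X.V.subtype ∘ₗ X.twistedAct z a) (X.bigraded.hom_ext fun n v hv => ?_) v
    simp [hW n v hv, X.twistedAct_apply ha hv, coe_leftAct]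

theorem leftAct_mul (a b : A) (v : X.V) : X.leftAct (a * b) v = X.leftAct a (X.leftAct b v) :=
  Subtype.ext (by simp [coe_leftAct])

/-- The bounded operator by which an element of the deformed algebra acts. -/
noncomputable def twistedOp (z : Circle) (a : A) : 𝓗 →L[ℂ] 𝓗 :=
  (X.exists_twistedAct_extension z a).choose

theorem twistedOp_apply (a : A) (v : X.V) : X.twistedOp z a v = X.twistedAct z a v :=
  (X.exists_twistedAct_extension z a).choose_spec.choose_spec.1 v

theorem twistedOp_add (a b : A) : X.twistedOp z (a + b) = X.twistedOp z a + X.twistedOp z b :=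
  X.ext_on_core fun v => by simp [twistedOp_apply]

theorem twistedOp_smul (c : ℂ) (a : A) : X.twistedOp z (c • a) = c • X.twistedOp z a :=
  X.ext_on_core fun v => by simp [twistedOp_apply]

variable [StarModule ℂ A]

theorem twistedAct_one (v : X.V) : X.twistedAct z 1 v = v :=
  LinearMap.congr_fun (f := X.twistedAct z 1) (g := LinearMap.id)
    (X.bigraded.hom_ext fun n v hv => by
      rw [X.twistedAct_apply CartanAction.one_mem_degreeSpace hv]
      exact Subtype.ext (by simp [coe_leftAct])) v

theorem twistedAct_mul (a b : A) (v : X.V) :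
    X.twistedAct z (𝒜.twistedMul z a b) v = X.twistedAct z a (X.twistedAct z b v) := by
  refine 𝒜.bigraded.induction (p := fun a => X.twistedAct z (𝒜.twistedMul z a b) v =
    X.twistedAct z a (X.twistedAct z b v)) (by simp) (fun x y hx hy => by simp [hx, hy]) ?_ a
  intro l a ha
  refine 𝒜.bigraded.induction (p := fun b => X.twistedAct z (𝒜.twistedMul z a b) v =
    X.twistedAct z a (X.twistedAct z b v)) (by simp) (fun x y hx hy => by simp [hx, hy]) ?_ b
  intro m b hb
  refine X.bigraded.induction (p := fun v => X.twistedAct z (𝒜.twistedMul z a b) v =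
    X.twistedAct z a (X.twistedAct z b v)) (by simp) (fun x y hx hy => by simp [hx, hy]) ?_ v
  intro n v hv
  rw [CartanAction.twistedMul_apply ha hb, map_smul, LinearMap.smul_apply,
    X.twistedAct_apply (CartanAction.mul_mem_degreeSpace ha hb) hv, X.twistedAct_apply hb hv,
    map_smul, X.twistedAct_apply ha (X.leftAct_mem_degreeSpace hb hv), leftAct_mul,
    circle_zpow_smul, circle_zpow_smul]
  congr 2
  simp only [Prod.fst_add, Prod.snd_add]
  ring

theorem inner_twistedAct_left (a : A) (v w : X.V) :
    ⟪(X.twistedAct z a v : 𝓗), (w : 𝓗)⟫_ℂ =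
      ⟪(v : 𝓗), (X.twistedAct z (𝒜.twistedStar z a) w : 𝓗)⟫_ℂ := by
  refine 𝒜.bigraded.induction (p := fun a => ⟪(X.twistedAct z a v : 𝓗), (w : 𝓗)⟫_ℂ =
    ⟪(v : 𝓗), (X.twistedAct z (𝒜.twistedStar z a) w : 𝓗)⟫_ℂ) (by simp [CartanAction.twistedStar])
    (fun x y hx hy => by
      rw [map_add, LinearMap.add_apply, CartanAction.twistedStar_add, map_add,
        LinearMap.add_apply, Submodule.coe_add, Submodule.coe_add, inner_add_left,
        inner_add_right, hx, hy]) ?_ a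
  intro m a ha
  refine X.bigraded.induction (p := fun v => ⟪(X.twistedAct z a v : 𝓗), (w : 𝓗)⟫_ℂ =
    ⟪(v : 𝓗), (X.twistedAct z (𝒜.twistedStar z a) w : 𝓗)⟫_ℂ) (by simp)
    (fun x y hx hy => by simp [hx, hy]) ?_ v
  intro n v hv
  refine X.bigraded.induction (p := fun w => ⟪(X.twistedAct z a v : 𝓗), (w : 𝓗)⟫_ℂ =
    ⟪(v : 𝓗), (X.twistedAct z (𝒜.twistedStar z a) w : 𝓗)⟫_ℂ) (by simp)
    (fun x y hx hy => by simp [hx, hy]) ?_ w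
  intro k w hw
  have hadj : ⟪(X.leftAct a v : 𝓗), (w : 𝓗)⟫_ℂ = ⟪(v : 𝓗), (X.leftAct (star a) w : 𝓗)⟫_ℂ := by
    rw [coe_leftAct, coe_leftAct, map_star, ContinuousLinearMap.star_eq_adjoint,
      ContinuousLinearMap.adjoint_inner_right]
  rw [CartanAction.twistedStar_apply ha, map_smul, LinearMap.smul_apply,
    X.twistedAct_apply ha hv, X.twistedAct_apply (CartanAction.star_mem_degreeSpace ha) hw,
    circle_zpow_smul, Submodule.coe_smul, Submodule.coe_smul, inner_smul_left, inner_smul_right,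
    conj_circle_zpow, ← hadj]
  by_cases hk : m + n = k
  · congr 2
    simp only [← hk, Prod.snd_add, Prod.fst_neg]
    ring
  · rw [X.inner_eq_zero_of_degree_ne hk (X.leftAct_mem_degreeSpace ha hv) hw, mul_zero, mul_zero]

theorem twistedOp_one : X.twistedOp z 1 = 1 :=
  X.ext_on_core fun v => by simp [twistedOp_apply, twistedAct_one]

theorem twistedOp_mul (a b : A) :
    X.twistedOp z (𝒜.twistedMul z a b) = X.twistedOp z a * X.twistedOp z b :=
  X.ext_on_core fun v => by simp [twistedOp_apply, twistedAct_mul]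

theorem inner_twistedOp_twistedStar (a : A) (x y : 𝓗) :
    ⟪X.twistedOp z (𝒜.twistedStar z a) x, y⟫_ℂ = ⟪x, X.twistedOp z a y⟫_ℂ := by
  -- Both sides are continuous in `x` and in `y`, so that the core suffices.
  refine congrFun (Continuous.ext_on X.dense (f := fun x => ⟪X.twistedOp z (𝒜.twistedStar z a) x,
    y⟫_ℂ) (g := fun x => ⟪x, X.twistedOp z a y⟫_ℂ) (by fun_prop) (by fun_prop) fun v hv => ?_) x
  refine congrFun (Continuous.ext_on X.dense (f := fun y => ⟪X.twistedOp z (𝒜.twistedStar z a) v,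
    y⟫_ℂ) (g := fun y => ⟪v, X.twistedOp z a y⟫_ℂ) (by fun_prop) (by fun_prop) fun w hw => ?_) y
  have h := X.inner_twistedAct_left (z := z) (𝒜.twistedStar z a) ⟨v, hv⟩ ⟨w, hw⟩
  rw [CartanAction.twistedStar_twistedStar, ← twistedOp_apply, ← twistedOp_apply] at h
  exact h

/-- The representation of the deformed algebra on the Hilbert space. -/
noncomputable def twistedRep (z : Circle) : 𝒜.Twisted z →⋆ₐ[ℂ] (𝓗 →L[ℂ] 𝓗) where
  __ := AlgHom.ofLinearMap (A := 𝒜.Twisted z) (B := 𝓗 →L[ℂ] 𝓗)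
    { toFun a := X.twistedOp z a
      map_add' := X.twistedOp_add
      map_smul' := X.twistedOp_smul }
    X.twistedOp_one X.twistedOp_mul
  map_star' a := by
    rw [ContinuousLinearMap.star_eq_adjoint]
    exact (ContinuousLinearMap.eq_adjoint_iff _ _).mpr (X.inner_twistedOp_twistedStar a)

theorem twistedRep_apply (a : A) (v : X.V) :
    X.twistedRep z (𝒜.quant z a) v = X.twistedAct z a v := X.twistedOp_apply a v

theorem twistedRep_mem (a : 𝒜.Twisted z) (v : 𝓗) (hv : v ∈ X.V) : X.twistedRep z a v ∈ X.V := by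
  have := X.twistedRep_apply (z := z) a ⟨v, hv⟩
  exact this ▸ (X.twistedAct z a ⟨v, hv⟩).2

theorem isSpectralTriple_twistedRep (z : Circle) : IsSpectralTriple (X.twistedRep z) X.D where
  dense_domain := X.isSpectralTriple.dense_domain
  selfAdjoint := X.isSpectralTriple.selfAdjoint
  compact_resolvent := X.isSpectralTriple.compact_resolvent
  bounded_commutator a := by
    obtain ⟨C, hC⟩ := (X.exists_twistedAct_extension z a).choose_spec
    exact ⟨C, hC.2⟩

end Phases

end SymmetricSpectralTriple

/-! ### The deformed real structure -/

section RightAction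

variable {B 𝓗 : Type*} [Ring B] [Algebra ℂ B] [StarRing B]
variable [NormedAddCommGroup 𝓗] [InnerProductSpace ℂ 𝓗]

theorem symm_apply_of_sq {J : 𝓗 ≃ₗᵢ⋆[ℂ] 𝓗} {ε : ℤˣ} (h : ∀ x, J (J x) = (ε : ℤ) • x) (x : 𝓗) :
    J.symm x = (ε : ℤ) • J x := by
  apply J.injective
  rw [J.apply_symm_apply, map_zsmul, h, smul_smul, Int.units_coe_mul_self, one_smul]

variable [CompleteSpace 𝓗]

theorem oppositeAct_add_left (π : B →⋆ₐ[ℂ] (𝓗 →L[ℂ] 𝓗)) (J : 𝓗 ≃ₗᵢ⋆[ℂ] 𝓗) (b c : B) (x : 𝓗) :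
    oppositeAct π J (b + c) x = oppositeAct π J b x + oppositeAct π J c x := by
  simp [oppositeAct, star_add]

theorem oppositeAct_zero_left (π : B →⋆ₐ[ℂ] (𝓗 →L[ℂ] 𝓗)) (J : 𝓗 ≃ₗᵢ⋆[ℂ] 𝓗) (x : 𝓗) :
    oppositeAct π J 0 x = 0 := by
  simp [oppositeAct]

theorem oppositeAct_add_right (π : B →⋆ₐ[ℂ] (𝓗 →L[ℂ] 𝓗)) (J : 𝓗 ≃ₗᵢ⋆[ℂ] 𝓗) (b : B) (x y : 𝓗) :
    oppositeAct π J b (x + y) = oppositeAct π J b x + oppositeAct π J b y := by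
  simp [oppositeAct]

theorem oppositeAct_smul_right (π : B →⋆ₐ[ℂ] (𝓗 →L[ℂ] 𝓗)) (J : 𝓗 ≃ₗᵢ⋆[ℂ] 𝓗) (b : B) (c : ℂ)
    (x : 𝓗) : oppositeAct π J b (c • x) = c • oppositeAct π J b x := by
  rw [oppositeAct, oppositeAct, map_smulₛₗ, map_smul, map_smulₛₗ]
  simp

theorem continuous_oppositeAct (π : B →⋆ₐ[ℂ] (𝓗 →L[ℂ] 𝓗)) (J : 𝓗 ≃ₗᵢ⋆[ℂ] 𝓗) (b : B) :
    Continuous (oppositeAct π J b) :=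
  J.continuous.comp ((π (star b)).continuous.comp J.symm.continuous)

theorem oppositeAct_of_sq (π : B →⋆ₐ[ℂ] (𝓗 →L[ℂ] 𝓗)) {J : 𝓗 ≃ₗᵢ⋆[ℂ] 𝓗} {ε : ℤˣ}
    (h : ∀ x, J (J x) = (ε : ℤ) • x) (b : B) (x : 𝓗) :
    oppositeAct π J b x = (ε : ℤ) • J (π (star b) (J x)) := by
  rw [oppositeAct, symm_apply_of_sq h, map_zsmul, map_zsmul]

end RightAction

namespace SymmetricSpectralTriple

section Real

variable {H : Type v} [Ring H] [HopfAlgebra ℂ H] [StarRing H]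
  {P : CartanPair H} {A : Type u} [Ring A] [Algebra ℂ A] [StarRing A] {𝒜 : CartanAction P A}
  {𝓗 : Type u} [NormedAddCommGroup 𝓗] [InnerProductSpace ℂ 𝓗] [CompleteSpace 𝓗]
  (X : SymmetricSpectralTriple 𝒜 𝓗) {z : Circle}

/-- The restriction of an antiunitary operator to the core. -/
def conjOn (J : 𝓗 ≃ₗᵢ⋆[ℂ] 𝓗) (hJ : ∀ v ∈ X.V, J v ∈ X.V) : X.V →ₗ⋆[ℂ] X.V where
  toFun v := ⟨J v, hJ v v.2⟩
  map_add' _ _ := Subtype.ext (map_add J _ _)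
  map_smul' c _ := Subtype.ext (map_smulₛₗ J c _)

variable {X} {J : 𝓗 ≃ₗᵢ⋆[ℂ] 𝓗} {hJ : ∀ v ∈ X.V, J v ∈ X.V}

theorem coe_conjOn (v : X.V) : (X.conjOn J hJ v : 𝓗) = J v := rfl

/-- An antiunitary operator with `J t = (S t)* J` reverses bidegrees. -/
theorem conjOn_mem_degreeSpace (hJt : ∀ (t : H) (v : X.V),
      J (X.rep t v) = X.rep (star (HopfAlgebra.antipode ℂ t)) ⟨J v, hJ v v.2⟩)
    {n : ℤ × ℤ} {v : X.V} (hv : v ∈ degreeSpace P X.rep n) :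
    X.conjOn J hJ v ∈ degreeSpace P X.rep (-n) := by
  have key (h : H) (hc : Coalgebra.comul (R := ℂ) h = 1 ⊗ₜ[ℂ] h + h ⊗ₜ[ℂ] 1) (hs : star h = h)
      (i : ℤ) (hi : X.rep h v = (i : ℂ) • v) :
      X.rep h (X.conjOn J hJ v) = ((-i : ℤ) : ℂ) • X.conjOn J hJ v := by
    have e : X.conjOn J hJ (X.rep h v) =
        X.rep (star (HopfAlgebra.antipode ℂ h)) (X.conjOn J hJ v) := Subtype.ext (hJt h v)
    rw [CartanAction.antipode_primitive hc, star_neg, hs, map_neg, LinearMap.neg_apply, hi,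
      map_smulₛₗ, map_intCast] at e
    rw [Int.cast_neg, neg_smul, e, neg_neg]
  rw [mem_degreeSpace] at hv ⊢
  exact ⟨key _ P.comul_h₁ P.star_h₁ _ hv.1, key _ P.comul_h₂ P.star_h₂ _ hv.2⟩

/-- On the core, `J U⁻¹ = U J`. -/
theorem conjOn_twistUInvOn (hJt : ∀ (t : H) (v : X.V),
      J (X.rep t v) = X.rep (star (HopfAlgebra.antipode ℂ t)) ⟨J v, hJ v v.2⟩) (v : X.V) :
    X.conjOn J hJ (twistUInvOn P z X.rep v) = twistUOn P z X.rep (X.conjOn J hJ v) := by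
  refine X.bigraded.induction (p := fun v => X.conjOn J hJ (twistUInvOn P z X.rep v) =
    twistUOn P z X.rep (X.conjOn J hJ v)) (by simp) (fun x y hx hy => by simp [hx, hy]) ?_ v
  intro n v hv
  rw [twistUInvOn_apply z hv, map_smulₛₗ, twistUOn_apply z (conjOn_mem_degreeSpace hJt hv),
    conj_circle_zpow, neg_neg, Prod.fst_neg, Prod.snd_neg, neg_mul_neg]

theorem exists_unitary_twistUInvOn (X : SymmetricSpectralTriple 𝒜 𝓗) (z : Circle) :
    ∃ W : 𝓗 ≃ₗᵢ[ℂ] 𝓗, (∀ v : X.V, W v = twistUInvOn P z X.rep v) ∧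
      IsCommutator X.D (W.toContinuousLinearEquiv : 𝓗 →L[ℂ] 𝓗) 0 := by
  obtain ⟨W, hW⟩ := X.exists_unitary_of_phase (z := z) (fun n => -(n.1 * n.2))
    (fun n v hv => twistUInvOn_apply z hv) (g := twistUOn P z X.rep)
    (fun n v hv => by rw [twistUOn_apply z hv, neg_neg])
  exact ⟨W, hW, X.isCommutator_zero_of_core hW
    (X.coreD_comm_of_phase (z := z) (fun n => -(n.1 * n.2)) fun n v hv => twistUInvOn_apply z hv)⟩

variable {J' : 𝓗 ≃ₗᵢ⋆[ℂ] 𝓗} {ε : ℤˣ}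

/-- `(J U⁻¹)² = J²`, because `U⁻¹ J = J U` on the core. -/
theorem sq_of_eq_twistUInvOn (hsq : ∀ x, J (J x) = (ε : ℤ) • x)
    (hJt : ∀ (t : H) (v : X.V),
      J (X.rep t v) = X.rep (star (HopfAlgebra.antipode ℂ t)) ⟨J v, hJ v v.2⟩)
    (hJ' : ∀ v : X.V, J' v = J (twistUInvOn P z X.rep v : X.V)) (x : 𝓗) :
    J' (J' x) = (ε : ℤ) • x := by
  refine congrFun (Continuous.ext_on X.dense (f := fun x => J' (J' x)) (g := fun x => (ε : ℤ) • x)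
    (J'.continuous.comp J'.continuous) (continuous_const_smul _) fun v hv => ?_) x
  have h1 := hJ' ⟨v, hv⟩
  have h2 := hJ' (X.conjOn J hJ (twistUInvOn P z X.rep ⟨v, hv⟩))
  have h3 := LinearMap.congr_fun (twistUInvOn_mul_twistUOn z X.bigraded) (X.conjOn J hJ ⟨v, hv⟩)
  rw [Module.End.mul_apply, Module.End.one_apply] at h3
  rw [conjOn_twistUInvOn hJt, h3, ← conjOn_twistUInvOn hJt, coe_conjOn, ← h1, coe_conjOn] at h2
  exact h2.trans (hsq v)

/-- Antilinearity of `J` turns the phase of `U⁻¹` into the phase of `U`. -/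
theorem conj_apply_of_degree (hJ' : ∀ v : X.V, J' v = J (twistUInvOn P z X.rep v : X.V))
    {n : ℤ × ℤ} {v : X.V} (hv : v ∈ degreeSpace P X.rep n) :
    J' v = ((z : ℂ) ^ (n.1 * n.2)) • J v := by
  rw [hJ', twistUInvOn_apply z hv, Submodule.coe_smul, map_smulₛₗ, conj_circle_zpow, neg_neg]

variable [StarModule ℂ A]

/-- The right action preserves the core, and adds bidegrees. -/
theorem exists_oppositeAct_mem (hsq : ∀ x, J (J x) = (ε : ℤ) • x)
    (hJt : ∀ (t : H) (v : X.V),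
      J (X.rep t v) = X.rep (star (HopfAlgebra.antipode ℂ t)) ⟨J v, hJ v v.2⟩)
    {k m : ℤ × ℤ} {b : A} {v : X.V} (hb : b ∈ degreeSpace P 𝒜.act k)
    (hv : v ∈ degreeSpace P X.rep m) :
    ∃ w ∈ degreeSpace P X.rep (m + k), (w : 𝓗) = oppositeAct X.π J b v := by
  have h := conjOn_mem_degreeSpace hJt (X.leftAct_mem_degreeSpace
    (CartanAction.star_mem_degreeSpace hb) (conjOn_mem_degreeSpace hJt hv))
  refine ⟨_, zsmul_mem (by simpa [add_comm] using h) (ε : ℤ), ?_⟩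
  rw [oppositeAct_of_sq _ hsq]
  rfl

/-- The right action of the deformed algebra is deformed by the same phases as the left action, with
the factors in the other order. -/
theorem oppositeAct_twistedRep (hsq : ∀ x, J (J x) = (ε : ℤ) • x)
    (hJt : ∀ (t : H) (v : X.V),
      J (X.rep t v) = X.rep (star (HopfAlgebra.antipode ℂ t)) ⟨J v, hJ v v.2⟩)
    (hJ' : ∀ v : X.V, J' v = J (twistUInvOn P z X.rep v : X.V))
    {k m : ℤ × ℤ} {b : A} {v : X.V} (hb : b ∈ degreeSpace P 𝒜.act k)
    (hv : v ∈ degreeSpace P X.rep m) :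
    oppositeAct (X.twistedRep z) J' (𝒜.quant z b) v =
      ((z : ℂ) ^ (m.1 * k.2)) • oppositeAct X.π J b v := by
  have hv' := conjOn_mem_degreeSpace hJt hv
  have hb' := CartanAction.star_mem_degreeSpace hb
  have e : X.twistedRep z (star (𝒜.quant z b)) (J v) =
      (((z : ℂ) ^ (k.1 * k.2 + k.1 * m.2)) • X.leftAct (star b) (X.conjOn J hJ v) : X.V) := by
    refine (X.twistedRep_apply (𝒜.twistedStar z b) (X.conjOn J hJ v)).trans ?_
    rw [CartanAction.twistedStar_apply hb, map_smul, LinearMap.smul_apply,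
      X.twistedAct_apply hb' hv', circle_zpow_smul, Prod.fst_neg, Prod.snd_neg, neg_mul_neg]
  rw [oppositeAct_of_sq _ (sq_of_eq_twistUInvOn hsq hJt hJ'), oppositeAct_of_sq _ hsq,
    conj_apply_of_degree hJ' hv, map_smul, e, ← Submodule.coe_smul, circle_zpow_smul,
    Submodule.coe_smul, map_smulₛₗ, conj_circle_zpow,
    conj_apply_of_degree hJ' (X.leftAct_mem_degreeSpace hb' hv'), circle_zpow_smul, coe_leftAct,
    coe_conjOn, smul_comm]
  congr 2
  simp only [Prod.fst_add, Prod.snd_add, Prod.fst_neg, Prod.snd_neg]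
  ring

/-- If `F` is an operator of degree `m` on the core which commutes with the right action, then its
deformation commutes with the deformed right action: the phases of both compositions agree. -/
theorem comm_oppositeAct_twistedRep (hsq : ∀ x, J (J x) = (ε : ℤ) • x)
    (hJt : ∀ (t : H) (v : X.V),
      J (X.rep t v) = X.rep (star (HopfAlgebra.antipode ℂ t)) ⟨J v, hJ v v.2⟩)
    (hJ' : ∀ v : X.V, J' v = J (twistUInvOn P z X.rep v : X.V))
    {m : ℤ × ℤ} {F G : Module.End ℂ X.V} {E : 𝓗 →L[ℂ] 𝓗} {C : 𝓗 →L[ℂ] 𝓗}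
    (hFE : ∀ v : X.V, E v = F v) (hGC : ∀ v : X.V, C v = G v)
    (hF : ∀ n, ∀ v ∈ degreeSpace P X.rep n, F v ∈ degreeSpace P X.rep (m + n))
    (hG : ∀ n, ∀ v ∈ degreeSpace P X.rep n, G v = ((z : ℂ) ^ (m.1 * n.2)) • F v)
    (hcomm : ∀ b x, E (oppositeAct X.π J b x) = oppositeAct X.π J b (E x))
    (b : 𝒜.Twisted z) (x : 𝓗) :
    C (oppositeAct (X.twistedRep z) J' b x) = oppositeAct (X.twistedRep z) J' b (C x) := by
  refine congrFun (Continuous.ext_on X.dense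
    (f := fun x => C (oppositeAct (X.twistedRep z) J' b x))
    (g := fun x => oppositeAct (X.twistedRep z) J' b (C x))
    (C.continuous.comp (continuous_oppositeAct _ _ _))
    ((continuous_oppositeAct _ _ _).comp C.continuous) fun v hv => ?_) x
  refine 𝒜.bigraded.induction (p := fun b : A =>
    C (oppositeAct (X.twistedRep z) J' (𝒜.quant z b) v) =
      oppositeAct (X.twistedRep z) J' (𝒜.quant z b) (C v)) ?_ ?_ ?_ b
  · rw [map_zero, oppositeAct_zero_left, oppositeAct_zero_left, map_zero]
  · intro b c hb hc
    rw [map_add, oppositeAct_add_left, oppositeAct_add_left, map_add, hb, hc]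
  intro k b hb
  refine X.bigraded.induction (p := fun v : X.V =>
    C (oppositeAct (X.twistedRep z) J' (𝒜.quant z b) v) =
      oppositeAct (X.twistedRep z) J' (𝒜.quant z b) (C v)) ?_ ?_ ?_ ⟨v, hv⟩
  · have h0 : oppositeAct (X.twistedRep z) J' (𝒜.quant z b) 0 = 0 := by simp [oppositeAct]
    rw [Submodule.coe_zero, map_zero, h0, map_zero]
  · intro v w hv hw
    rw [Submodule.coe_add, map_add, oppositeAct_add_right, oppositeAct_add_right, map_add, hv, hw]
  intro n v hv
  obtain ⟨w, hw, hw'⟩ := exists_oppositeAct_mem hsq hJt hb hv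
  rw [oppositeAct_twistedRep hsq hJt hJ' hb hv, hGC, hG n v hv, map_smul, ← hw', hGC, hG _ w hw,
    Submodule.coe_smul, Submodule.coe_smul, oppositeAct_smul_right,
    oppositeAct_twistedRep hsq hJt hJ' hb (hF n v hv), circle_zpow_smul, circle_zpow_smul, ← hFE,
    ← hFE, hw', hcomm]
  congr 2
  simp only [Prod.fst_add, Prod.snd_add]
  ring

theorem order_zero_twistedRep (hsq : ∀ x, J (J x) = (ε : ℤ) • x)
    (hJt : ∀ (t : H) (v : X.V),
      J (X.rep t v) = X.rep (star (HopfAlgebra.antipode ℂ t)) ⟨J v, hJ v v.2⟩)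
    (hJ' : ∀ v : X.V, J' v = J (twistUInvOn P z X.rep v : X.V))
    (h : ∀ a b x, X.π a (oppositeAct X.π J b x) = oppositeAct X.π J b (X.π a x))
    (a b : 𝒜.Twisted z) (x : 𝓗) : X.twistedRep z a (oppositeAct (X.twistedRep z) J' b x) =
      oppositeAct (X.twistedRep z) J' b (X.twistedRep z a x) := by
  refine 𝒜.bigraded.induction (p := fun a : A =>
    X.twistedRep z (𝒜.quant z a) (oppositeAct (X.twistedRep z) J' b x) =
      oppositeAct (X.twistedRep z) J' b (X.twistedRep z (𝒜.quant z a) x)) ?_ ?_ ?_ a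
  · simp [oppositeAct]
  · intro a c ha hc
    rw [map_add, map_add, add_apply, add_apply, oppositeAct_add_right, ha, hc]
  · intro m a ha
    exact comm_oppositeAct_twistedRep hsq hJt hJ' (F := X.leftAct a) (G := X.twistedAct z a)
      (X.coe_leftAct a · |>.symm) (X.twistedRep_apply a)
      (fun n v hv => X.leftAct_mem_degreeSpace ha hv) (fun n v hv => X.twistedAct_apply ha hv)
      (h a) b x

theorem order_one_twistedRep (hsq : ∀ x, J (J x) = (ε : ℤ) • x)
    (hJt : ∀ (t : H) (v : X.V),
      J (X.rep t v) = X.rep (star (HopfAlgebra.antipode ℂ t)) ⟨J v, hJ v v.2⟩)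
    (hJ' : ∀ v : X.V, J' v = J (twistUInvOn P z X.rep v : X.V))
    (h : ∀ a b C, IsCommutator X.D (X.π a) C →
      ∀ x, C (oppositeAct X.π J b x) = oppositeAct X.π J b (C x))
    (a b : 𝒜.Twisted z) (C : 𝓗 →L[ℂ] 𝓗) (hC : IsCommutator X.D (X.twistedRep z a) C) (x : 𝓗) :
    C (oppositeAct (X.twistedRep z) J' b x) = oppositeAct (X.twistedRep z) J' b (C x) := by
  -- A bounded commutator is determined by its restriction to the core, which is additive in `a`.
  have core {a : A} {T C : 𝓗 →L[ℂ] 𝓗} {f : Module.End ℂ X.V} (hT : ∀ v : X.V, T v = f v)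
      (hC : IsCommutator X.D T C) (v : X.V) :
      C v = (X.coreD ∘ₗ f - f ∘ₗ X.coreD : Module.End ℂ X.V) v := by
    obtain ⟨hv, e⟩ := hC ⟨v, X.core.le_domain v.2⟩
    rw [← e]
    refine congrArg₂ (· - ·) (congrArg X.D (Subtype.ext (hT v))) (hT (X.coreD v))
  suffices key : ∀ a : A, ∃ C : 𝓗 →L[ℂ] 𝓗,
      (∀ v : X.V, C v = (X.coreD ∘ₗ X.twistedAct z a - X.twistedAct z a ∘ₗ X.coreD :
        Module.End ℂ X.V) v) ∧ ∀ x, C (oppositeAct (X.twistedRep z) J' b x) =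
          oppositeAct (X.twistedRep z) J' b (C x) by
    obtain ⟨C', h1, h2⟩ := key a
    have : C = C' := X.ext_on_core fun v => by
      rw [h1, core (a := a) (X.twistedRep_apply a) hC]
    rw [this]
    exact h2 x
  intro a
  refine 𝒜.bigraded.induction (p := fun a => ∃ C : 𝓗 →L[ℂ] 𝓗,
      (∀ v : X.V, C v = (X.coreD ∘ₗ X.twistedAct z a - X.twistedAct z a ∘ₗ X.coreD :
        Module.End ℂ X.V) v) ∧ ∀ x, C (oppositeAct (X.twistedRep z) J' b x) =
          oppositeAct (X.twistedRep z) J' b (C x)) ⟨0, by simp, by simp [oppositeAct]⟩ ?_ ?_ a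
  · rintro a c ⟨C, hC, hC'⟩ ⟨E, hE, hE'⟩
    refine ⟨C + E, fun v => ?_, fun x => ?_⟩
    · rw [add_apply, hC, hE, ← Submodule.coe_add, ← LinearMap.add_apply, map_add,
        LinearMap.comp_add, LinearMap.add_comp, add_sub_add_comm]
    · rw [add_apply, add_apply, hC', hE', oppositeAct_add_right]
  · intro m a ha
    obtain ⟨E, hE⟩ := X.isSpectralTriple.bounded_commutator a
    obtain ⟨T, C, hT, hC⟩ := X.exists_twistedAct_extension z a
    refine ⟨C, core (a := a) hT hC, comm_oppositeAct_twistedRep (m := m) hsq hJt hJ'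
      (core (a := a) (X.coe_leftAct a · |>.symm) hE) (core (a := a) hT hC)
      (fun n v hv => sub_mem (X.coreD_mem_degreeSpace (X.leftAct_mem_degreeSpace ha hv))
        (X.leftAct_mem_degreeSpace ha (X.coreD_mem_degreeSpace hv))) (fun n v hv => ?_)
      (fun b x => h a b E hE x) b⟩
    simp only [LinearMap.sub_apply, LinearMap.comp_apply]
    rw [X.twistedAct_apply ha hv, X.twistedAct_apply ha (X.coreD_mem_degreeSpace hv), map_smul,
      smul_sub]

end Real

end SymmetricSpectralTriple

/-! ### The deformed module algebra -/

namespace CartanAction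

variable {H : Type v} [Ring H] [HopfAlgebra ℂ H] [StarRing H] {P : CartanPair H}
variable {A : Type u} [Ring A] [Algebra ℂ A] [StarRing A] (𝒜 : CartanAction P A) {z : Circle}

theorem mul'_tensorAct (t : H) (x : A ⊗[ℂ] A) :
    LinearMap.mul' ℂ A (tensorAct 𝒜.act 𝒜.act t x) = 𝒜.act t (LinearMap.mul' ℂ A x) :=
  LinearMap.congr_fun (f := LinearMap.mul' ℂ A ∘ₗ tensorAct 𝒜.act 𝒜.act t)
    (g := 𝒜.act t ∘ₗ LinearMap.mul' ℂ A)
    (TensorProduct.ext' fun a b => (𝒜.act_mul t a b).symm) x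

theorem mul'_twisted [StarModule ℂ A] (x : A ⊗[ℂ] A) : LinearMap.mul' ℂ (𝒜.Twisted z) x =
    LinearMap.mul' ℂ A (cartanTwistInv P z 𝒜.act 𝒜.act x) :=
  LinearMap.congr_fun (f := (LinearMap.mul' ℂ (𝒜.Twisted z) : A ⊗[ℂ] A →ₗ[ℂ] A))
    (g := LinearMap.mul' ℂ A ∘ₗ cartanTwistInv P z 𝒜.act 𝒜.act)
    (TensorProduct.ext' fun _ _ => rfl) x

end CartanAction

/-! ### Covariance and the crossed product -/

namespace SymmetricSpectralTriple

section Covariance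

variable {H : Type v} [Ring H] [HopfAlgebra ℂ H] [StarRing H]
  {P : CartanPair H} {A : Type u} [Ring A] [Algebra ℂ A] [StarRing A] {𝒜 : CartanAction P A}
  {𝓗 : Type u} [NormedAddCommGroup 𝓗] [InnerProductSpace ℂ 𝓗] [CompleteSpace 𝓗]
  (X : SymmetricSpectralTriple 𝒜 𝓗) {z : Circle}

theorem moduleMap_tensorAct (t : H) (x : A ⊗[ℂ] X.V) :
    moduleMap X.π X.V X.π_mem (tensorAct 𝒜.act X.rep t x) =
      X.rep t (moduleMap X.π X.V X.π_mem x) := by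
  induction x using TensorProduct.induction_on with
  | zero => simp
  | add x y hx hy => simp only [map_add, hx, hy]
  | tmul a v => exact (X.rep_π t a v).symm

/-- Operators on the core which commute with `H` commute with `H_Ψ`. -/
theorem actV_comm {f : Module.End ℂ X.V} (hf : ∀ t v, f (X.rep t v) = X.rep t (f v))
    (T : twistedSymmetry.{u} P z) (v : X.V) : f (X.actV T.1 v) = X.actV T.1 (f v) :=
  twistedSymmetry_natural T.2 (M := X.weightModule) (N := X.weightModule) f hf v

theorem actV_twistedAct (T : twistedSymmetry.{u} P z) (a : A) (v : X.V) :
    X.actV T.1 (X.twistedAct z a v) =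
      moduleMap X.π X.V X.π_mem (cartanTwistInv P z 𝒜.act X.rep
        (twistedComul z T.1 (𝒜.twistedWeightModule z) X.weightModule (a ⊗ₜ[ℂ] v))) :=
  natural_comp_cartanTwistInv T.2 (M := 𝒜.twistedWeightModule z) (N := X.weightModule)
    (Q := X.weightModule) (moduleMap X.π X.V X.π_mem) X.moduleMap_tensorAct (a ⊗ₜ[ℂ] v)

/-- The actions of the deformed algebra and of `H_Ψ` on the core, on the generators of the crossed
product. -/
noncomputable def crossedGen (z : Circle) :
    FreeAlgebra ℂ (𝒜.Twisted z ⊕ twistedSymmetry.{u} P z) →ₐ[ℂ] Module.End ℂ X.V :=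
  FreeAlgebra.lift ℂ (Sum.elim (fun a => X.twistedAct z a) (fun T => X.actV T.1))

theorem crossedGen_inl (a : 𝒜.Twisted z) :
    X.crossedGen z (FreeAlgebra.ι ℂ (Sum.inl a)) = X.twistedAct z a := by
  simp [crossedGen]

theorem crossedGen_inr (T : twistedSymmetry.{u} P z) :
    X.crossedGen z (FreeAlgebra.ι ℂ (Sum.inr T)) = X.actV T.1 := by
  simp [crossedGen]

variable [StarModule ℂ A]

theorem moduleMap_twistedRep (x : A ⊗[ℂ] X.V) :
    moduleMap (X.twistedRep z) X.V X.twistedRep_mem x =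
      moduleMap X.π X.V X.π_mem (cartanTwistInv P z 𝒜.act X.rep x) :=
  LinearMap.congr_fun
    (f := (moduleMap (X.twistedRep z) X.V X.twistedRep_mem : A ⊗[ℂ] X.V →ₗ[ℂ] X.V))
    (g := moduleMap X.π X.V X.π_mem ∘ₗ cartanTwistInv P z 𝒜.act X.rep)
    (TensorProduct.ext' fun a v => Subtype.ext (X.twistedRep_apply a v)) x

theorem crossedGen_rel {x y : FreeAlgebra ℂ (𝒜.Twisted z ⊕ twistedSymmetry.{u} P z)}
    (h : CartanAction.CrossedRel 𝒜 z x y) : X.crossedGen z x = X.crossedGen z y := by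
  induction h with
  | alg_smul c a =>
    simp only [map_smul, crossedGen_inl]
    exact map_smul (X.twistedAct z) c a
  | alg_add a b =>
    simp only [map_add, crossedGen_inl]
    exact map_add (X.twistedAct z) a b
  | alg_mul a b =>
    simp only [map_mul, crossedGen_inl]
    exact LinearMap.ext fun v => X.twistedAct_mul a b v
  | alg_one =>
    simp only [map_one, crossedGen_inl]
    exact LinearMap.ext fun v => X.twistedAct_one v
  | sym_smul c T => simp only [map_smul, crossedGen_inr]; rfl
  | sym_add S T => simp only [map_add, crossedGen_inr]; rfl
  | sym_mul S T => simp only [map_mul, crossedGen_inr]; rfl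
  | sym_one => simp only [map_one, crossedGen_inr]; rfl
  | cross T a k b T₂ h =>
    simp only [map_mul, map_sum, crossedGen_inl, crossedGen_inr]
    refine LinearMap.ext fun v => ?_
    rw [Module.End.mul_apply, LinearMap.sum_apply]
    refine (X.actV_twistedAct T a v).trans ?_
    rw [h X.weightModule v]
    exact map_sum (moduleMap X.π X.V X.π_mem ∘ₗ cartanTwistInv P z 𝒜.act X.rep) _ _

/-- The representation of the crossed product on the core. -/
noncomputable def crossedRep (z : Circle) :
    CartanAction.CrossedProduct.{u} 𝒜 z →ₐ[ℂ] Module.End ℂ X.V :=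
  RingQuot.liftAlgHom ℂ ⟨X.crossedGen z, fun _ _ h => X.crossedGen_rel h⟩

theorem crossedRep_ofAlg (a : 𝒜.Twisted z) :
    X.crossedRep z (CartanAction.CrossedProduct.ofAlg 𝒜 z a) = X.twistedAct z a :=
  (RingQuot.liftAlgHom_mkAlgHom_apply ℂ _ _ _).trans (X.crossedGen_inl a)

theorem crossedRep_ofSym (T : twistedSymmetry.{u} P z) :
    X.crossedRep z (CartanAction.CrossedProduct.ofSym 𝒜 z T) = X.actV T.1 :=
  (RingQuot.liftAlgHom_mkAlgHom_apply ℂ _ _ _).trans (X.crossedGen_inr T)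

/-! ### Gradings -/

variable {γ : 𝓗 →L[ℂ] 𝓗} {hγ : ∀ v ∈ X.V, γ v ∈ X.V}

theorem isGrading_twistedRep (h : IsGrading X.π X.D γ)
    (hγt : ∀ (t : H) (v : X.V), γ (X.rep t v) = X.rep t ⟨γ v, hγ v v.2⟩) :
    IsGrading (X.twistedRep z) X.D γ where
  selfAdjoint := h.selfAdjoint
  sq := h.sq
  comm a := X.ext_on_core fun v => by
    let γV : Module.End ℂ X.V := (γ : 𝓗 →ₗ[ℂ] 𝓗).restrict hγ
    have e : (X.twistedAct z).compr₂ γV = (X.twistedAct z).compl₂ γV :=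
      𝒜.bigraded.hom_ext₂ X.bigraded fun m n a ha v hv => by
        have hγv : γV v ∈ degreeSpace P X.rep n :=
          map_mem_degreeSpace (fun t v => Subtype.ext (hγt t v)) hv
        rw [LinearMap.compr₂_apply, LinearMap.compl₂_apply, X.twistedAct_apply ha hv,
          X.twistedAct_apply ha hγv, map_smul]
        exact congrArg _ (Subtype.ext (congrArg (fun T : 𝓗 →L[ℂ] 𝓗 => T v) (h.comm a)).symm)
    have e' := congrArg Subtype.val (LinearMap.congr_fun (LinearMap.congr_fun e a) v)
    exact ((X.twistedRep_apply a (γV v)).trans e'.symm).trans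
      (congrArg γ (X.twistedRep_apply a v)).symm
  anticomm := h.anticomm

end Covariance

end SymmetricSpectralTriple

theorem mainTheorem1 {H : Type v} [Ring H] [HopfAlgebra ℂ H] [StarRing H] [StarModule ℂ H]
    [IsHopfStar H] (P : CartanPair H)
    {A : Type u} [Ring A] [Algebra ℂ A] [StarRing A] [StarModule ℂ A] (𝒜 : CartanAction P A)
    {𝓗 : Type u} [NormedAddCommGroup 𝓗] [InnerProductSpace ℂ 𝓗] [CompleteSpace 𝓗]
    (X : SymmetricSpectralTriple 𝒜 𝓗) (z : Circle) :
    -- `A_Ψ` is a module `*`-algebra over `H_Ψ`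
    (∀ (T : twistedSymmetry.{u} P z) (a b : 𝒜.Twisted z),
      T.1 (𝒜.twistedWeightModule z) ((a * b : 𝒜.Twisted z)) =
        LinearMap.mul' ℂ (𝒜.Twisted z)
          (twistedComul z T.1 (𝒜.twistedWeightModule z) (𝒜.twistedWeightModule z)
            (a ⊗ₜ[ℂ] b))) ∧
    (∀ t : H, (𝒜.twistedWeightModule z).act t (1 : 𝒜.Twisted z) =
      Coalgebra.counit (R := ℂ) t • (1 : 𝒜.Twisted z)) ∧
    (∀ (t : H) (a : 𝒜.Twisted z), (𝒜.twistedWeightModule z).act t (star a : 𝒜.Twisted z) =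
      (star (starTwistedAntipode P z t (𝒜.twistedWeightModule z) a : 𝒜.Twisted z) :
        𝒜.Twisted z)) ∧
    (∀ (T : twistedSymmetry.{u} P z) (a : 𝒜.Twisted z), ∃ (k : ℕ) (b : Fin k → 𝒜.Twisted z)
      (T₂ : Fin k → twistedSymmetry.{u} P z), 𝒜.IsCoaction z T a b T₂) ∧
    -- the representation of `A_Ψ`
    ∃ (πΨ : 𝒜.Twisted z →⋆ₐ[ℂ] (𝓗 →L[ℂ] 𝓗)) (hV : ∀ a, ∀ v ∈ X.V, πΨ a v ∈ X.V),
      (∀ (a : A) (v : X.V), πΨ (𝒜.quant z a) v =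
        moduleMap X.π X.V X.π_mem (cartanTwistInv P z 𝒜.act X.rep (a ⊗ₜ[ℂ] v))) ∧
      -- its covariance, and the representation of the crossed product
      (∀ (T : twistedSymmetry.{u} P z) (a : 𝒜.Twisted z) (v : X.V),
        X.actV T.1 ⟨πΨ a v, hV a v v.2⟩ = moduleMap πΨ X.V hV
          (twistedComul z T.1 (𝒜.twistedWeightModule z) X.weightModule (a ⊗ₜ[ℂ] v))) ∧
      (∃ Φ : CartanAction.CrossedProduct.{u} 𝒜 z →ₐ[ℂ] Module.End ℂ X.V,
        (∀ (a : 𝒜.Twisted z) (v : X.V),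
          ((Φ (CartanAction.CrossedProduct.ofAlg 𝒜 z a) v : X.V) : 𝓗) = πΨ a v) ∧
        ∀ T : twistedSymmetry.{u} P z,
          Φ (CartanAction.CrossedProduct.ofSym 𝒜 z T) = X.actV T.1) ∧
      -- the spectral triple for `A_Ψ`, with the same `D`, on which `H_Ψ` acts by isometries
      IsSpectralTriple πΨ X.D ∧
      (∀ (T : twistedSymmetry.{u} P z) (v : X.V), X.DV (X.actV T.1 v) = X.actV T.1 (X.DV v)) ∧
      -- the even case
      (∀ γ : 𝓗 →L[ℂ] 𝓗, IsGrading X.π X.D γ → ∀ hγ : ∀ v ∈ X.V, γ v ∈ X.V,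
        (∀ (t : H) (v : X.V), γ (X.rep t v) = X.rep t ⟨γ v, hγ v v.2⟩) →
        IsGrading πΨ X.D γ ∧
        ∀ (T : twistedSymmetry.{u} P z) (v : X.V),
          γ (X.actV T.1 v) = X.actV T.1 ⟨γ v, hγ v v.2⟩) ∧
      -- the real case
      (∀ (J : 𝓗 ≃ₗᵢ⋆[ℂ] 𝓗) (ε ε' : ℤˣ), IsRealStructure X.π X.D J ε ε' →
        ∀ hJ : ∀ v ∈ X.V, J v ∈ X.V,
        (∀ (t : H) (v : X.V),
          J (X.rep t v) = X.rep (star (HopfAlgebra.antipode ℂ t)) ⟨J v, hJ v v.2⟩) →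
        ∃ (J' : 𝓗 ≃ₗᵢ⋆[ℂ] 𝓗) (hJ' : ∀ v ∈ X.V, J' v ∈ X.V),
          (∀ v : X.V, J' v = J (twistUInvOn P z X.rep v : X.V)) ∧
          IsRealStructure πΨ X.D J' ε ε' ∧
          (∀ (t : H) (v : X.V),
            J' (X.rep t v) = X.actV (starTwistedAntipode P z t) ⟨J' v, hJ' v v.2⟩) ∧
          ∀ (γ : 𝓗 →L[ℂ] 𝓗) (ε'' : ℤˣ), IsGrading X.π X.D γ →
            ∀ hγ : ∀ v ∈ X.V, γ v ∈ X.V,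
            (∀ (t : H) (v : X.V), γ (X.rep t v) = X.rep t ⟨γ v, hγ v v.2⟩) →
            (∀ x, J (γ x) = (ε'' : ℤ) • γ (J x)) → ∀ x, J' (γ x) = (ε'' : ℤ) • γ (J' x)) := by
  refine ⟨fun T a b => ?_, 𝒜.act_one, fun t a => ?_, fun T a => ?_, X.twistedRep z,
    X.twistedRep_mem, X.twistedRep_apply, fun T a v => ?_, ⟨X.crossedRep z, fun a v => ?_,
    X.crossedRep_ofSym⟩, X.isSpectralTriple_twistedRep z, X.actV_comm (f := X.coreD) X.coreD_rep,
    fun γ h hγ hγt => ⟨X.isGrading_twistedRep h hγt, fun T v => ?_⟩,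
    fun J ε ε' h hJ hJt => ?_⟩
  · exact (natural_comp_cartanTwistInv T.2 (M := 𝒜.twistedWeightModule z)
      (N := 𝒜.twistedWeightModule z) (Q := 𝒜.twistedWeightModule z) (LinearMap.mul' ℂ A)
      𝒜.mul'_tensorAct (a ⊗ₜ[ℂ] b)).trans (𝒜.mul'_twisted _).symm
  · have e := LinearMap.congr_fun (twistUInvOn_mul_twistUOn z 𝒜.bigraded)
      (𝒜.act (star (HopfAlgebra.antipode ℂ t)) (twistUInvOn P z 𝒜.act a))
    exact (𝒜.act_star t _).trans (congrArg star e.symm)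
  · obtain ⟨θ, hθ⟩ := exists_twistedComul_eq T.2 (𝒜.twistedWeightModule z) a
    obtain ⟨k, b, T₂, rfl⟩ := θ.exists_sum_tmul_eq
    exact ⟨k, b, T₂, fun M m => by rw [hθ, map_sum]; rfl⟩
  · exact (congrArg (X.actV T.1) (Subtype.ext (X.twistedRep_apply a v))).trans
      ((X.actV_twistedAct T a v).trans (X.moduleMap_twistedRep _).symm)
  · rw [X.crossedRep_ofAlg]
    exact (X.twistedRep_apply a v).symm
  · exact congrArg Subtype.val (X.actV_comm (f := (γ : 𝓗 →ₗ[ℂ] 𝓗).restrict hγ)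
      (fun t v => Subtype.ext (hγt t v)) T v)
  · obtain ⟨W, hW, hWD⟩ := X.exists_unitary_twistUInvOn z
    have hJ' (v : X.V) : W.trans J v = J (twistUInvOn P z X.rep v : X.V) := congrArg J (hW v)
    have hmem : ∀ v ∈ X.V, W.trans J v ∈ X.V := fun v hv => hJ' ⟨v, hv⟩ ▸ hJ _ (Subtype.coe_prop _)
    refine ⟨W.trans J, hmem, hJ',
      ⟨SymmetricSpectralTriple.sq_of_eq_twistUInvOn h.sq hJt hJ', fun x => ?_,
        SymmetricSpectralTriple.order_zero_twistedRep h.sq hJt hJ' h.order_zero,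
        SymmetricSpectralTriple.order_one_twistedRep h.sq hJt hJ' h.order_one⟩, fun t v => ?_, ?_⟩
    · obtain ⟨hx, e⟩ := hWD x
      obtain ⟨hy, e'⟩ := h.comm ⟨W x, hx⟩
      rw [zero_apply, sub_eq_zero] at e
      exact ⟨hy, e'.trans (congrArg (fun y => (ε' : ℤ) • J y) e)⟩
    · -- With `J' = J U⁻¹ = U J` both sides are equal to `U (S t)* J v`.
      have hU (w : X.V) : (⟨W.trans J w, hmem w w.2⟩ : X.V) =
          twistUOn P z X.rep (X.conjOn J hJ w) :=
        (Subtype.ext (hJ' w)).trans (SymmetricSpectralTriple.conjOn_twistUInvOn hJt w)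
      have e := LinearMap.congr_fun (twistUInvOn_mul_twistUOn z X.bigraded) (X.conjOn J hJ v)
      have e' : X.conjOn J hJ (X.rep t v) =
          X.rep (star (HopfAlgebra.antipode ℂ t)) (X.conjOn J hJ v) := Subtype.ext (hJt t v)
      rw [hU v]
      refine (congrArg Subtype.val (hU (X.rep t v))).trans (congrArg Subtype.val ?_)
      rw [e']
      exact congrArg (fun w => twistUOn P z X.rep
        (X.rep (star (HopfAlgebra.antipode ℂ t)) w)) e.symm
    · intro γ ε'' _ hγ hγt hJγ x
      refine congrFun (Continuous.ext_on X.dense (f := fun x => W.trans J (γ x))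
        (g := fun x => (ε'' : ℤ) • γ (W.trans J x)) ((W.trans J).continuous.comp γ.continuous)
        
        ((γ.continuous.comp (W.trans J).continuous).const_smul (ε'' : ℤ)) fun v hv => ?_) x
      let γV : Module.End ℂ X.V := (γ : 𝓗 →ₗ[ℂ] 𝓗).restrict hγ
      have hc : twistUInvOn P z X.rep ∘ₗ γV = γV ∘ₗ twistUInvOn P z X.rep :=
        X.bigraded.hom_ext fun n w hw => by
          have hγw : γV w ∈ degreeSpace P X.rep n :=
            map_mem_degreeSpace (fun t v => Subtype.ext (hγt t v)) hw
          rw [LinearMap.comp_apply, LinearMap.comp_apply, twistUInvOn_apply z hw,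
            twistUInvOn_apply z hγw, map_smul]
      have e := congrArg (fun w : X.V => J w) (LinearMap.congr_fun hc ⟨v, hv⟩)
      exact (hJ' (γV ⟨v, hv⟩)).trans (e.trans ((hJγ _).trans
        (congrArg (fun y => (ε'' : ℤ) • γ y) (hJ' ⟨v, hv⟩).symm)))
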